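/- Let $n\ge 1$ be an integer and let $a<b$ be real numbers. Let $\mathcal A_c$ be the space of distributions $T$ on $(a,b)$ of the form $T=F'$ (distributional derivative) with $F\in C([a,b])$, $F(a)=0$; the primitive $F$ is unique, and one writes $\int_a^xT=F(x)$. The Alexiewicz norm of $T$ is $\|T\|=\sup_{a\le x\le b}\left|\int_a^xT\right|$, and for $g$ of bounded variation $\int_a^bT\,g=F(b)g(b)-F(a)g(a)-\int_a^bF\,dg$ (Riemann–Stieltjes integral). Let $T_n$ be the Chebyshev polynomial of the first kind, put $\tilde\phi_n=2^{1-n}(T_n-1)$ and $$\phi_n(x)=\left(\frac{b-a}{2}\right)^n\tilde\phi_n\!\left(\frac{2x-a-b}{b-a}\right).$$ (i) The polynomial $\phi_n$ is monic of degree $n$, and it is the unique minimizer of $|\phi(b)|+V_{[a,b]}\phi$ among the monic real polynomials $\phi$ of degree $n$, where $V_{[a,b]}\phi$ is the total variation of $\phi$ on $[a,b]$. (ii) Let $f:[a,b]\to\mathbb R$ be such that the pointwise derivative $f^{(n-1)}$ exists and is continuous on $[a,b]$ (one-sided derivatives at the end points). Then the $n$-th distributional derivative $f^{(n)}$ lies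 in $\mathcal A_c$, the integral in $$E_n(f)=\frac{(-1)^n}{n!}\int_a^bf^{(n)}\phi_n$$ exists, $$\int_a^bf(x)\,dx=\frac1{(n-1)!}\sum_{k=0}^{n-2}\frac{(b-a)^{k+1}(2n-k-2)!\,(n-k-1)!}{2^{2k+1}(2n-2k-2)!\,(k+1)!}\left[f^{(k)}(a)+(-1)^kf^{(k)}(b)\right]+R_n(f)+E_n(f),$$ where $R_n(f)=\dfrac{(b-a)^nf^{(n-1)}(a)}{n!\,2^{2n-2}}$ if $n$ is odd and $R_n(f)=0$ if $n$ is even, and $$|E_n(f)|\le\frac{\|f^{(n)}\|\,(b-a)^n}{(n-1)!\,2^{2n-2}}.$$ (iii) The coefficient of $\|f^{(n)}\|$ in this estimate is sharp: if $c\in\mathbb R$ is such that $|E_n(f)|\le c\,\|f^{(n)}\|$ for all $f$ as in (ii), then $c\ge\dfrac{(b-a)^n}{(n-1)!\,2^{2n-2}}$. -/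

import Mathlib

noncomputable section

namespace CPI

open Set MeasureTheory TopologicalSpace Polynomial
open scoped Distributions Nat LineDeriv

/-- The open interval `(a, b)` as an open subset of `ℝ`. -/
def openInterval (a b : ℝ) : Opens ℝ := ⟨Ioo a b, isOpen_Ioo⟩

/-- The distribution `φ ↦ ∫ φ(x) f(x) dx` on `(a, b)` given by a function `f` that is locally
integrable on `(a, b)`. -/
def ofFun (a b : ℝ) (f : ℝ → ℝ) : 𝓓'(openInterval a b, ℝ) :=
  ContinuousLinearMap.toUniformConvergenceCLM (RingHom.id ℝ) ℝ _
    (TestFunction.integralAgainstBilinCLM (ContinuousLinearMap.mul ℝ ℝ) volume f)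

/-- The distributional derivative, `⟨T', φ⟩ = -⟨T, φ'⟩`. -/
def distDeriv {a b : ℝ} (T : 𝓓'(openInterval a b, ℝ)) : 𝓓'(openInterval a b, ℝ) :=
  ∂_{(1 : ℝ)} T

/-- The `n`-th distributional derivative on `(a, b)` of a function on `[a, b]`. -/
def distDerivFun (n : ℕ) (a b : ℝ) (f : ℝ → ℝ) : 𝓓'(openInterval a b, ℝ) :=
  distDeriv^[n] (ofFun a b f)

/-- `F` is a continuous function on `[a, b]` with `F(a) = 0` whose distributional derivative
is `T`. -/
def IsPrimitive {a b : ℝ} (F : ℝ → ℝ) (T : 𝓓'(openInterval a b, ℝ)) : Prop :=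
  ContinuousOn F (Icc a b) ∧ F a = 0 ∧ distDeriv (ofFun a b F) = T

/-- The space `𝒜_c` of distributions on `(a, b)` that are integrable in the sense of the continuous
primitive integral. -/
def Ac (a b : ℝ) : Set 𝓓'(openInterval a b, ℝ) :=
  {T | ∃ F : ℝ → ℝ, IsPrimitive F T}

open Classical in
/-- The continuous primitive integral `x ↦ ∫_a^x T`, that is, the primitive of `T` (unique on
`[a, b]`); a junk value if `T ∉ 𝒜_c`. -/
def cpIntegral {a b : ℝ} (T : 𝓓'(openInterval a b, ℝ)) : ℝ → ℝ :=
  if h : ∃ F : ℝ → ℝ, IsPrimitive F T then h.choose else 0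

/-- The Alexiewicz norm `sup_{a ≤ x ≤ b} |∫_a^x T|`. -/
def alexNorm {a b : ℝ} (T : 𝓓'(openInterval a b, ℝ)) : ℝ :=
  sSup ((fun x => |cpIntegral T x|) '' Icc a b)

/-- `I` is the Riemann–Stieltjes integral `∫_a^b F dg`: the limit of the sums over tagged
partitions of `[a, b]` as the mesh tends to zero. -/
def HasRSIntegral (a b : ℝ) (F g : ℝ → ℝ) (I : ℝ) : Prop :=
  ∀ ε > 0, ∃ δ > 0, ∀ (N : ℕ) (x t : ℕ → ℝ), Monotone x → x 0 = a → x N = b →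
    (∀ i < N, x (i + 1) - x i < δ) → (∀ i < N, t i ∈ Icc (x i) (x (i + 1))) →
    |∑ i ∈ Finset.range N, F (t i) * (g (x (i + 1)) - g (x i)) - I| < ε

/-- `I` is the continuous primitive integral `∫_a^b T g`, defined by integration by parts:
`I = F(b) g(b) - F(a) g(a) - ∫_a^b F dg` with `F` the primitive of `T`. -/
def HasCPIntegralMul {a b : ℝ} (T : 𝓓'(openInterval a b, ℝ)) (g : ℝ → ℝ) (I : ℝ) : Prop :=
  ∃ F : ℝ → ℝ, IsPrimitive F T ∧
    ∃ J : ℝ, HasRSIntegral a b F g J ∧ I = F b * g b - F a * g a - J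

open Classical in
/-- The value of `∫_a^b T g`; a junk value if this integral does not exist. -/
def cpIntegralMul {a b : ℝ} (T : 𝓓'(openInterval a b, ℝ)) (g : ℝ → ℝ) : ℝ :=
  if h : ∃ I : ℝ, HasCPIntegralMul T g I then h.choose else 0

/-- The polynomial `2^{1-n} (T_n - 1)` on `[-1, 1]`. -/
def minPoly (n : ℕ) : ℝ[X] :=
  C ((2 : ℝ) ^ (1 - (n : ℤ))) * (Chebyshev.T ℝ n - 1)

/-- Its transplant `((b-a)/2)^n · 2^{1-n} (T_n((2x-a-b)/(b-a)) - 1)` to `[a, b]`. -/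
def minPolyOn (n : ℕ) (a b : ℝ) : ℝ[X] :=
  C (((b - a) / 2) ^ n) *
    (minPoly n).comp (C (2 / (b - a)) * X - C ((a + b) / (b - a)))

/-- The factor `|p(b)| + Vp` of the Hölder inequality, with `Vp` the variation of `p` on
`[a, b]`. -/
def holderFactor (a b : ℝ) (p : ℝ[X]) : ENNReal :=
  ENNReal.ofReal |p.eval b| + eVariationOn (fun x => p.eval x) (Icc a b)

/-- The quadrature rule. The derivatives of `f` are taken within `[a, b]`, so one-sided at the
end points. -/
def quadRule (n : ℕ) (a b : ℝ) (f : ℝ → ℝ) : ℝ :=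
  1 / ((n - 1)! : ℝ) * ∑ k ∈ Finset.range (n - 1),
      ((b - a) ^ (k + 1) * ((2 * n - k - 2)! : ℝ) * ((n - k - 1)! : ℝ) /
        (2 ^ (2 * k + 1) * ((2 * n - 2 * k - 2)! : ℝ) * ((k + 1)! : ℝ))) *
      (iteratedDerivWithin k f (Icc a b) a + (-1) ^ k * iteratedDerivWithin k f (Icc a b) b)
  + if Odd n then
      (b - a) ^ n * iteratedDerivWithin (n - 1) f (Icc a b) a / ((n ! : ℝ) * 2 ^ (2 * n - 2))
    else 0

/-- The error `E_n(f) = ((-1)^n / n!) ∫_a^b f^{(n)} φ_n` as a continuous primitive integral. -/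
def quadError (n : ℕ) (a b : ℝ) (f : ℝ → ℝ) : ℝ :=
  (-1) ^ n / (n ! : ℝ) *
    cpIntegralMul (distDerivFun n a b f) (fun x => (minPolyOn n a b).eval x)

end CPI

end

/-! Everything rests on one linear functional: the alternating sum of increments over the Chebyshev
nodes `cos (kπ/n)`. It annihilates polynomials of degree below `n` and sends `T_n` to `2n`, so it
sees only the coefficient of degree `n`. After transplanting to `[a, b]`, every monic `p` of degree
`n` gets the same value `V = n (b-a)^n / 2^(2n-2)` (`altSum_eval_nodeOn`).

Minimality: the alternating sum is a lower bound for the variation, and `φ_n` attains it, being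
monotone between consecutive nodes and zero at `b`. If `p` also attains `V`, then `p(b) = 0`, and no
shift of an interior node can increase the sum, so `p'` vanishes at all `n - 1` interior nodes. The
same holds for `φ_n`, and a root count for `(p - φ_n)'` gives `p = φ_n`.

Quadrature: the primitive of `f^(n)` is `F = f^(n-1) - f^(n-1)(a)`, unique by du Bois-Reymond's
lemma. As `φ_n(b) = 0`, the integral of `f^(n) φ_n` is `-∫ F φ_n'`. Integrating by parts down to
`φ_n^(n) = n!` gives the rule, with coefficients read off from the derivatives of `T_n` at `±1`. The
error is at most `‖f^(n)‖ V / n!`.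

Sharpness: continuous `F` with `|F| ≤ 1` and `F(a) = 0` approximating the sign of `φ_n'` push `∫ F
φ_n'` to `∫ |φ_n'|`, which is at least `V`. -/

noncomputable section

namespace CPI

open Set MeasureTheory TopologicalSpace Polynomial
open scoped Distributions Nat LineDeriv

/-! ### Alternating sums over the Chebyshev nodes -/

/-- The alternating sum `∑_{k < n} (-1)^k (u k - u (k + 1))`. -/
def altSum (n : ℕ) (u : ℕ → ℝ) : ℝ :=
  ∑ k ∈ Finset.range n, (-1) ^ k * (u k - u (k + 1))

lemma altSum_add (n : ℕ) (u v : ℕ → ℝ) :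
    altSum n (fun k => u k + v k) = altSum n u + altSum n v := by
  simp only [altSum, ← Finset.sum_add_distrib]
  exact Finset.sum_congr rfl fun k _ => by ring

lemma altSum_const_mul (n : ℕ) (c : ℝ) (u : ℕ → ℝ) :
    altSum n (fun k => c * u k) = c * altSum n u := by
  simp only [altSum, Finset.mul_sum]
  exact Finset.sum_congr rfl fun k _ => by ring

lemma altSum_congr {n : ℕ} {u v : ℕ → ℝ} (h : ∀ k ≤ n, u k = v k) : altSum n u = altSum n v := by
  refine Finset.sum_congr rfl fun k hk => ?_
  rw [Finset.mem_range] at hk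
  rw [h k hk.le, h (k + 1) hk]

lemma altSum_neg_one_pow (n : ℕ) : altSum n (fun k => (-1) ^ k) = 2 * n := by
  have : ∀ k ∈ Finset.range n, (-1 : ℝ) ^ k * ((-1) ^ k - (-1) ^ (k + 1)) = 2 := fun k _ => by
    rw [pow_succ]
    have : ((-1 : ℝ) ^ k) * (-1) ^ k = 1 := by rw [← mul_pow]; simp
    linear_combination 2 * this
  rw [altSum, Finset.sum_congr rfl this]
  simp [mul_comm]

/-- The sum telescopes: each summand times `sin (β/2)` is `cos (β/2) (sin ((k+1)β) - sin (kβ))`. -/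
lemma sin_half_mul_sum_cos (β : ℝ) (n : ℕ) :
    Real.sin (β / 2) * ∑ k ∈ Finset.range n, (Real.cos (k * β) + Real.cos ((k + 1 : ℕ) * β)) =
      Real.cos (β / 2) * Real.sin (n * β) := by
  induction n with
  | zero => simp
  | succ n ih =>
    rw [Finset.sum_range_succ, mul_add, ih]
    have e : ((n + 1 : ℕ) : ℝ) * β = n * β + 2 * (β / 2) := by push_cast; ring
    rw [e, Real.cos_add, Real.sin_add, Real.sin_two_mul, Real.cos_two_mul]
    have := Real.sin_sq_add_cos_sq (β / 2)
    linear_combination (-2 * Real.sin (n * β) * Real.cos (β / 2)) * this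

/-- Shifting the angle `mπ/n` by `π` absorbs the sign `(-1)^k`. Then `nβ` is a multiple of `π`,
while `m < n` keeps `β/2` strictly between `0` and `π`, so the sine in front can be cancelled. -/
lemma altSum_cos_eq_zero {n m : ℕ} (hm : m < n) :
    altSum n (fun k => Real.cos (m * (k * Real.pi / n))) = 0 := by
  have hn : (0 : ℝ) < n := by exact_mod_cast (Nat.zero_le m).trans_lt hm
  set β : ℝ := m * Real.pi / n + Real.pi with hβ
  have key : ∀ k : ℕ, Real.cos (k * β) = (-1) ^ k * Real.cos (m * (k * Real.pi / n)) := by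
    intro k
    have : k * β = m * (k * Real.pi / n) + k * Real.pi := by rw [hβ]; ring
    rw [this, Real.cos_add_nat_mul_pi]
  have hsum : altSum n (fun k => Real.cos (m * (k * Real.pi / n))) =
      ∑ k ∈ Finset.range n, (Real.cos (k * β) + Real.cos ((k + 1 : ℕ) * β)) := by
    refine Finset.sum_congr rfl fun k _ => ?_
    rw [key, key, pow_succ]; ring
  have hsin : Real.sin (n * β) = 0 := by
    have : n * β = ((m + n : ℕ) : ℝ) * Real.pi := by
      rw [hβ]; push_cast; field_simp
    rw [this]; exact Real.sin_nat_mul_pi _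
  have hlt : m * Real.pi / n < Real.pi := by
    rw [div_lt_iff₀ hn, mul_comm]
    exact mul_lt_mul_of_pos_left (by exact_mod_cast hm) Real.pi_pos
  have h0 : 0 ≤ m * Real.pi / n := by positivity
  have hpos : 0 < Real.sin (β / 2) :=
    Real.sin_pos_of_pos_of_lt_pi (by have := Real.pi_pos; linarith) (by linarith)
  have := sin_half_mul_sum_cos β n
  rw [hsin, mul_zero, ← hsum] at this
  exact (mul_eq_zero.mp this).resolve_left hpos.ne'

/-- At the nodes `T_d` takes the values `cos (dkπ/n)`, so the cosine sum settles `T_d` for `d < n`.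
Cancelling the leading term with a multiple of `T_d` reduces the degree. -/
lemma altSum_eval_node_eq_zero {n : ℕ} (q : ℝ[X]) (hq : q.degree < n) :
    altSum n (fun k => q.eval (Chebyshev.node n k)) = 0 := by
  generalize hd : q.natDegree = d
  induction d using Nat.strong_induction_on generalizing q with
  | _ d ih =>
    by_cases h0 : q = 0
    · simp [h0, altSum]
    have hdn : d < n := by
      rw [← hd]; exact (natDegree_lt_iff_degree_lt h0).mpr hq
    have hT : altSum n (fun k => (Chebyshev.T ℝ d).eval (Chebyshev.node n k)) = 0 := by
      simp only [Chebyshev.node, Chebyshev.T_real_cos]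
      exact_mod_cast altSum_cos_eq_zero hdn
    set c : ℝ := q.leadingCoeff / 2 ^ (d - 1) with hc
    have hc0 : c ≠ 0 := div_ne_zero (leadingCoeff_ne_zero.mpr h0) (by positivity)
    have hdeg : (C c * Chebyshev.T ℝ d).degree = q.degree := by
      rw [degree_C_mul hc0, Chebyshev.degree_T, degree_eq_natDegree h0, hd]; simp
    have hlt : (q - C c * Chebyshev.T ℝ d).degree < q.degree := by
      refine degree_sub_lt_left hdeg.symm h0 ?_
      rw [leadingCoeff_mul, leadingCoeff_C, Chebyshev.leadingCoeff_T, hc]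
      simp
    have hrest : altSum n
        (fun k => (q - C c * Chebyshev.T ℝ d).eval (Chebyshev.node n k)) = 0 := by
      by_cases hr : q - C c * Chebyshev.T ℝ d = 0
      · simp [hr, altSum]
      · exact ih _ ((natDegree_lt_natDegree hr hlt).trans_eq hd) _ (hlt.trans hq) rfl
    have : (fun k => q.eval (Chebyshev.node n k)) = fun k =>
        (q - C c * Chebyshev.T ℝ d).eval (Chebyshev.node n k) +
          c * (Chebyshev.T ℝ d).eval (Chebyshev.node n k) := by
      ext k; simp
    rw [this, altSum_add, altSum_const_mul, hT, hrest]; simp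

/-- Modulo lower degree `q` is a multiple of `T_n`, which equals `(-1)^k` at the nodes. -/
lemma altSum_eval_node {n : ℕ} (q : ℝ[X]) (hq : q.natDegree ≤ n) :
    altSum n (fun k => q.eval (Chebyshev.node n k)) = q.coeff n * (2 * n) / 2 ^ (n - 1) := by
  set c : ℝ := q.coeff n / 2 ^ (n - 1) with hc
  have hcoeff : (Chebyshev.T ℝ n).coeff n = 2 ^ (n - 1) := by
    have := Chebyshev.leadingCoeff_T ℝ n
    rwa [leadingCoeff, Chebyshev.natDegree_T, Int.natAbs_natCast] at this
  have hlt : (q - C c * Chebyshev.T ℝ n).degree < n := by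
    rw [degree_lt_iff_coeff_zero]
    intro m hm
    rcases hm.eq_or_lt with rfl | hm
    · simp [hcoeff, hc]
    · rw [coeff_sub, coeff_C_mul, coeff_eq_zero_of_natDegree_lt (hq.trans_lt hm),
        coeff_eq_zero_of_natDegree_lt (by simpa using hm)]
      simp
  have : (fun k => q.eval (Chebyshev.node n k)) = fun k =>
      (q - C c * Chebyshev.T ℝ n).eval (Chebyshev.node n k) +
        c * (Chebyshev.T ℝ n).eval (Chebyshev.node n k) := by
    ext k; simp
  rw [this, altSum_add, altSum_const_mul, altSum_eval_node_eq_zero _ hlt,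
    altSum_congr fun k hk => Chebyshev.eval_T_real_node (Finset.mem_Iic.mpr hk),
    altSum_neg_one_pow, hc]
  ring

/-- The extremal points of the transplanted Chebyshev polynomial on `[a, b]`. -/
def nodeOn (n : ℕ) (a b : ℝ) (k : ℕ) : ℝ :=
  (b - a) / 2 * Chebyshev.node n k + (a + b) / 2

lemma nodeOn_mem_Icc {n k : ℕ} {a b : ℝ} (hab : a < b) : nodeOn n a b k ∈ Icc a b := by
  have h := (Chebyshev.node_mem_Icc : Chebyshev.node n k ∈ _)
  constructor <;> unfold nodeOn <;> nlinarith [h.1, h.2]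

lemma nodeOn_lt {n i j : ℕ} {a b : ℝ} (hab : a < b) (hj : j ≤ n) (hij : i < j) :
    nodeOn n a b j < nodeOn n a b i := by
  have := Chebyshev.node_lt hj hij
  unfold nodeOn
  have h2 : 0 < (b - a) / 2 := by linarith
  nlinarith [mul_lt_mul_of_pos_left this h2]

lemma altSum_eval_nodeOn {n : ℕ} (hn : 1 ≤ n) {a b : ℝ} (p : ℝ[X])
    (hp : p.Monic) (hpn : p.natDegree = n) :
    altSum n (fun k => p.eval (nodeOn n a b k)) = n * (b - a) ^ n / 2 ^ (2 * n - 2) := by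
  set L : ℝ[X] := C ((b - a) / 2) * X + C ((a + b) / 2) with hL
  have hLdeg : L.natDegree ≤ 1 := natDegree_linear_le
  have hdeg : (p.comp L).natDegree ≤ n := by
    refine natDegree_comp_le.trans ?_
    rw [hpn]; nlinarith
  have hcoeff : (p.comp L).coeff n = ((b - a) / 2) ^ n := by
    have := coeff_comp_degree_mul_degree (p := p) (q := L)
    rcases eq_or_ne ((b - a) / 2) 0 with h | h
    · have : L = C ((a + b) / 2) := by rw [hL, h]; simp
      rw [this, comp_C, h, zero_pow (by omega), coeff_C, if_neg (by omega)]
    · have h1 : L.natDegree = 1 := natDegree_linear h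
      rw [h1, hpn, mul_one] at this
      rw [this one_ne_zero, hp.leadingCoeff, hL, leadingCoeff_linear h]; simp
  have := altSum_eval_node (p.comp L) hdeg
  rw [hcoeff] at this
  have e : (fun k => p.eval (nodeOn n a b k)) =
      fun k => (p.comp L).eval (Chebyshev.node n k) := by
    ext k; simp [hL, nodeOn]
  rw [e, this]
  obtain ⟨m, rfl⟩ : ∃ m, n = m + 1 := ⟨n - 1, by omega⟩
  have : 2 * (m + 1) - 2 = m + m := by omega
  rw [this, Nat.add_sub_cancel, pow_add, div_pow]
  field_simp
  ring

/-- The points run from right to left, as the Chebyshev nodes do, so the order is reversed before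
comparing with the variation. -/
lemma ofReal_altSum_le_eVariationOn {n : ℕ} {s : Set ℝ} (g : ℝ → ℝ) {y : ℕ → ℝ}
    (hy : AntitoneOn y (Iic n)) (hys : ∀ k ≤ n, y k ∈ s) :
    ENNReal.ofReal (altSum n (fun k => g (y k))) ≤ eVariationOn g s := by
  have h := eVariationOn.sum_le_of_monotoneOn_Iic (f := g) (s := s) (n := n)
    (u := fun k => y (n - k)) (fun i hi j hj hij => hy (by simp) (by simp) (by omega))
    (fun i _ => hys _ (by omega))
  refine le_trans ?_ h
  rw [← Finset.sum_range_reflect]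
  refine le_trans (ENNReal.ofReal_le_ofReal (Finset.sum_le_sum fun k hk =>
    (le_abs_self _ : _ ≤ |(-1) ^ k * (g (y k) - g (y (k + 1)))|))) ?_
  rw [ENNReal.ofReal_sum_of_nonneg fun _ _ => abs_nonneg _]
  refine le_of_eq (Finset.sum_congr rfl fun k hk => ?_)
  rw [Finset.mem_range] at hk
  have h1 : n - (n - 1 - k + 1) = k := by omega
  have h2 : n - (n - 1 - k) = k + 1 := by omega
  simp only [h1, h2]
  rw [edist_dist, Real.dist_eq, abs_mul]
  simp

/-! ### Derivatives of `T_n` at `1` and `-1` -/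

lemma iterate_derivative_comp_linear (p : ℝ[X]) (c d : ℝ) (m : ℕ) :
    derivative^[m] (p.comp (C c * X + C d)) =
      C (c ^ m) * (derivative^[m] p).comp (C c * X + C d) := by
  induction m with
  | zero => simp
  | succ m ih =>
    rw [Function.iterate_succ_apply', ih, Function.iterate_succ_apply', derivative_C_mul,
      derivative_comp, pow_succ, C_mul]
    simp
    ring

/-- Differentiate the parity relation `T_n(-x) = (-1)^n T_n(x)`. -/
lemma iterate_derivative_T_eval_neg_one (n m : ℕ) :
    (derivative^[m] (Chebyshev.T ℝ n)).eval (-1) =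
      (-1) ^ (n + m) * (derivative^[m] (Chebyshev.T ℝ n)).eval 1 := by
  have h : (Chebyshev.T ℝ n).comp (C (-1) * X + C 0) = C ((-1) ^ n) * Chebyshev.T ℝ n := by
    refine Polynomial.funext fun x => ?_
    simp
  have h2 := iterate_derivative_comp_linear (Chebyshev.T ℝ n) (-1) 0 m
  rw [h, iterate_derivative_C_mul] at h2
  have h3 := congrArg (eval 1) h2
  simp only [eval_mul, eval_C, eval_comp, eval_add, eval_X] at h3
  norm_num at h3
  have : ((-1 : ℝ) ^ m) * (-1) ^ m = 1 := by rw [← mul_pow]; simp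
  rw [pow_add]
  linear_combination (-(eval (-1) (derivative^[m] (Chebyshev.T ℝ n)))) * this - (-1) ^ m * h3

/-- Induction with the recurrence `(2m+1) T_n^(m+1)(1) = (n² - m²) T_n^(m)(1)`. The factorials are
cross-multiplied to avoid division. -/
lemma iterate_derivative_T_eval_one_mul_factorial {n m : ℕ} (hn : 1 ≤ n) (hm : m ≤ n) :
    (derivative^[m] (Chebyshev.T ℝ n)).eval 1 * (((n - m)! : ℝ) * ((2 * m)! : ℝ)) =
      n * ((n + m - 1)! : ℝ) * 2 ^ m * (m ! : ℝ) := by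
  induction m with
  | zero =>
    obtain ⟨k, rfl⟩ : ∃ k, n = k + 1 := ⟨n - 1, by omega⟩
    simp [Nat.factorial_succ]
  | succ m ih =>
    have ih := ih (by omega)
    have hrec := Chebyshev.iterate_derivative_T_eval_one_recurrence (R := ℝ) n m
    push_cast at hrec
    obtain ⟨k, rfl⟩ : ∃ k, n = m + 1 + k := ⟨n - (m + 1), by omega⟩
    have e1 : m + 1 + k - m = k + 1 := by omega
    have e2 : m + 1 + k - (m + 1) = k := by omega
    have e3 : m + 1 + k + m - 1 = 2 * m + k := by omega
    have e4 : m + 1 + k + (m + 1) - 1 = 2 * m + k + 1 := by omega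
    have e5 : 2 * (m + 1) = 2 * m + 1 + 1 := by omega
    rw [e1, e3] at ih
    rw [e2, e4, e5]
    simp only [Nat.factorial_succ] at ih ⊢
    push_cast at ih hrec ⊢
    set D := eval 1 (derivative^[m] (Chebyshev.T ℝ ((m : ℤ) + 1 + k)))
    set D' := eval 1 (derivative^[m + 1] (Chebyshev.T ℝ ((m : ℤ) + 1 + k)))
    linear_combination ((k ! : ℝ) * (2 * m + 2) * ((2 * m)! : ℝ)) * hrec +
      (2 * m + 2) * (2 * m + 1 + k) * ih

/-! ### The polynomial `φ_n` and its variation -/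

/-- The leading factor `((b - a) / 2)^n 2^{1-n}` of `minPolyOn`. -/
def minPolyScale (n : ℕ) (a b : ℝ) : ℝ := ((b - a) / 2) ^ n * (2 : ℝ) ^ (1 - (n : ℤ))

lemma minPolyScale_pos {n : ℕ} {a b : ℝ} (hab : a < b) : 0 < minPolyScale n a b := by
  have : 0 < (b - a) / 2 := by linarith
  unfold minPolyScale; positivity

lemma minPolyScale_eq {n : ℕ} (hn : 1 ≤ n) (a b : ℝ) :
    2 * minPolyScale n a b = (b - a) ^ n / 2 ^ (2 * n - 2) := by
  obtain ⟨m, rfl⟩ : ∃ m, n = m + 1 := ⟨n - 1, by omega⟩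
  have e1 : 2 * (m + 1) - 2 = m + m := by omega
  have e2 : (1 : ℤ) - ((m + 1 : ℕ) : ℤ) = -(m : ℤ) := by push_cast; ring
  rw [minPolyScale, e1, e2, zpow_neg, zpow_natCast, pow_add, div_pow]
  field_simp
  ring

lemma minPolyOn_eq (n : ℕ) (a b : ℝ) :
    minPolyOn n a b = C (minPolyScale n a b) *
      (Chebyshev.T ℝ n - 1).comp (C (2 / (b - a)) * X + C (-((a + b) / (b - a)))) := by
  rw [minPolyOn, minPoly, minPolyScale, mul_comp, C_comp, C_mul, mul_assoc, C_neg, ← sub_eq_add_neg]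

lemma eval_minPolyOn (n : ℕ) (a b x : ℝ) :
    (minPolyOn n a b).eval x = minPolyScale n a b *
      ((Chebyshev.T ℝ n).eval (2 / (b - a) * x + -((a + b) / (b - a))) - 1) := by
  simp [minPolyOn_eq]

lemma affine_left {a b : ℝ} (hab : a < b) : 2 / (b - a) * a + -((a + b) / (b - a)) = -1 := by
  have : b - a ≠ 0 := by linarith
  field_simp; ring

lemma affine_right {a b : ℝ} (hab : a < b) : 2 / (b - a) * b + -((a + b) / (b - a)) = 1 := by
  have : b - a ≠ 0 := by linarith
  field_simp; ring

lemma eval_minPolyOn_right (n : ℕ) {a b : ℝ} (hab : a < b) : (minPolyOn n a b).eval b = 0 := by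
  rw [eval_minPolyOn, affine_right hab]; simp

lemma eval_minPolyOn_left (n : ℕ) {a b : ℝ} (hab : a < b) :
    (minPolyOn n a b).eval a = minPolyScale n a b * ((-1) ^ n - 1) := by
  rw [eval_minPolyOn, affine_left hab]; simp

lemma eval_iterate_derivative_minPolyOn (n : ℕ) {m : ℕ} (hm : 1 ≤ m) (a b x : ℝ) :
    (derivative^[m] (minPolyOn n a b)).eval x = minPolyScale n a b * ((2 / (b - a)) ^ m *
      (derivative^[m] (Chebyshev.T ℝ n)).eval (2 / (b - a) * x + -((a + b) / (b - a)))) := by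
  have : derivative^[m] (1 : ℝ[X]) = 0 := iterate_derivative_one hm
  rw [minPolyOn_eq, iterate_derivative_C_mul, iterate_derivative_comp_linear,
    iterate_derivative_sub, this]
  simp

lemma minPolyOn_monic_natDegree {n : ℕ} (hn : 1 ≤ n) {a b : ℝ} (hab : a < b) :
    (minPolyOn n a b).Monic ∧ (minPolyOn n a b).natDegree = n := by
  have hba : b - a ≠ 0 := by linarith
  have h2 : (2 / (b - a)) ≠ 0 := div_ne_zero two_ne_zero hba
  have hlt : (1 : ℝ[X]).natDegree < (Chebyshev.T ℝ n).natDegree := by simp; omega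
  have hdT : (Chebyshev.T ℝ n - 1).natDegree = n := by
    rw [natDegree_sub_eq_left_of_natDegree_lt hlt]; simp
  have hlT : (Chebyshev.T ℝ n - 1).leadingCoeff = 2 ^ (n - 1) := by
    rw [leadingCoeff_sub_of_degree_lt (degree_lt_degree hlt)]; simp
  have hd : (minPolyOn n a b).natDegree = n := by
    rw [minPolyOn_eq, natDegree_C_mul (minPolyScale_pos hab).ne', natDegree_comp, hdT,
      natDegree_linear h2, mul_one]
  refine ⟨?_, hd⟩
  rw [Monic, minPolyOn_eq, leadingCoeff_mul, leadingCoeff_C,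
    leadingCoeff_comp (by rw [natDegree_linear h2]; exact one_ne_zero), hlT, hdT,
    leadingCoeff_linear h2]
  have hs := minPolyScale_eq hn a b
  obtain ⟨m, rfl⟩ : ∃ m, n = m + 1 := ⟨n - 1, by omega⟩
  have e1 : 2 * (m + 1) - 2 = m + m := by omega
  rw [e1, pow_add 2] at hs
  have : minPolyScale (m + 1) a b = (b - a) ^ (m + 1) / (2 ^ m * 2 ^ m) / 2 := by linarith
  rw [this, Nat.add_sub_cancel, div_pow]
  field_simp
  ring

/-- In the variable `θ = arccos y` the polynomial is `κ (cos (nθ) - 1)`. It is monotone on each of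
the `n` intervals of length `π/n`, with oscillation `2κ`. -/
lemma eVariationOn_minPolyOn_le {n : ℕ} (hn : 1 ≤ n) {a b : ℝ} (hab : a < b) :
    eVariationOn (fun x => (minPolyOn n a b).eval x) (Icc a b) ≤
      ENNReal.ofReal (n * (b - a) ^ n / 2 ^ (2 * n - 2)) := by
  have hn0 : (0 : ℝ) < n := by exact_mod_cast hn
  have hba : 0 < b - a := by linarith
  have hκ := minPolyScale_pos (n := n) hab
  set κ := minPolyScale n a b with hκdef
  set h : ℝ → ℝ := fun θ => κ * (Real.cos (n * θ) - 1) with hh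
  set y : ℝ → ℝ := fun x => 2 / (b - a) * x + -((a + b) / (b - a)) with hy
  have hymono : Monotone y := fun u v huv => by
    simp only [hy]
    have := mul_le_mul_of_nonneg_left huv (by positivity : 0 ≤ 2 / (b - a))
    linarith
  have hcongr : EqOn (fun x => (minPolyOn n a b).eval x) (h ∘ fun x => Real.arccos (y x))
      (Icc a b) := by
    intro x hx
    have h1 : -1 ≤ y x := by rw [← affine_left hab]; exact hymono hx.1
    have h2 : y x ≤ 1 := by rw [← affine_right hab]; exact hymono hx.2
    have := Chebyshev.T_real_cos (Real.arccos (y x)) n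
    rw [Real.cos_arccos h1 h2] at this
    simp only [Function.comp_apply, hh]
    rw [eval_minPolyOn, this]
    simp [hκdef]
  rw [eVariationOn.eq_of_eqOn hcongr]
  refine (eVariationOn.comp_le_of_antitoneOn (s := Icc 0 Real.pi) h _
    (fun u _ v _ huv => Real.antitone_arccos (hymono huv))
    (fun x _ => ⟨Real.arccos_nonneg _, Real.arccos_le_pi _⟩)).trans ?_
  set I : ℕ → ℝ := fun k => k * Real.pi / n with hI
  have hImono : Monotone I := fun i j hij => by
    simp only [hI]
    gcongr
  have hI0 : I 0 = 0 := by simp [hI]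
  have hIn : I n = Real.pi := by simp only [hI]; field_simp
  rw [← hI0, ← hIn, ← eVariationOn.sum' h hImono]
  have hpiece : ∀ k ∈ Finset.range n,
      eVariationOn h (Icc (I k) (I (k + 1))) ≤ ENNReal.ofReal (2 * κ) := by
    intro k _
    -- Subtracting `kπ` moves the `k`-th piece to `[0, π]`, where cosine is antitone; the resulting
    -- sign goes into the `κ`-Lipschitz map `G`.
    set G : ℝ → ℝ := fun z => κ * ((-1) ^ k * z - 1) with hG
    have hGL : LipschitzOnWith κ.toNNReal G univ := by
      refine LipschitzOnWith.of_dist_le_mul fun z _ w _ => ?_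
      rw [Real.dist_eq, Real.dist_eq, Real.coe_toNNReal _ hκ.le]
      have : G z - G w = κ * ((-1) ^ k * (z - w)) := by simp only [hG]; ring
      rw [this, abs_mul, abs_mul, abs_of_pos hκ]; simp
    have hcomp : h = G ∘ fun θ => Real.cos (n * θ - k * Real.pi) := by
      ext θ
      simp only [hh, hG, Function.comp_apply, Real.cos_sub_nat_mul_pi]
      have : ((-1 : ℝ) ^ k) * (-1) ^ k = 1 := by rw [← mul_pow]; simp
      linear_combination (-κ * Real.cos (n * θ)) * this
    rw [hcomp]
    refine (hGL.comp_eVariationOn_le (mapsTo_univ _ _)).trans ?_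
    have hmem : ∀ θ ∈ Icc (I k) (I (k + 1)), n * θ - k * Real.pi ∈ Icc 0 Real.pi := by
      intro θ hθ
      have h1 : k * Real.pi ≤ θ * n := (div_le_iff₀ hn0).mp hθ.1
      have h2 : θ * n ≤ ((k + 1 : ℕ) : ℝ) * Real.pi := (le_div_iff₀ hn0).mp hθ.2
      push_cast at h2
      constructor <;> linarith
    have hcos : eVariationOn (fun θ => Real.cos (n * θ - k * Real.pi)) (Icc (I k) (I (k + 1))) ≤
        ENNReal.ofReal 2 := by
      have := eVariationOn.comp_le_of_antitoneOn (s := Icc (-1 : ℝ) 1) (id : ℝ → ℝ)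
        (t := Icc (I k) (I (k + 1))) (fun θ => Real.cos (n * θ - k * Real.pi))
        (fun u hu v hv huv => Real.strictAntiOn_cos.antitoneOn (hmem u hu) (hmem v hv)
          (by have := mul_le_mul_of_nonneg_left huv hn0.le; linarith))
        (fun θ _ => ⟨Real.neg_one_le_cos _, Real.cos_le_one _⟩)
      rw [eVariationOn_id_Icc] at this
      refine this.trans (le_of_eq ?_)
      norm_num
    calc _ ≤ (κ.toNNReal : ENNReal) * ENNReal.ofReal 2 := by gcongr
      _ = ENNReal.ofReal (2 * κ) := by
        rw [mul_comm 2 κ, ENNReal.ofReal_mul hκ.le]; rfl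
  refine (Finset.sum_le_sum hpiece).trans ?_
  rw [Finset.sum_const, Finset.card_range, hκdef, minPolyScale_eq hn, nsmul_eq_mul,
    mul_div_assoc, ENNReal.ofReal_mul hn0.le, ENNReal.ofReal_natCast]

lemma holderFactor_minPolyOn_le {n : ℕ} (hn : 1 ≤ n) {a b : ℝ} (hab : a < b) :
    holderFactor a b (minPolyOn n a b) ≤ ENNReal.ofReal (n * (b - a) ^ n / 2 ^ (2 * n - 2)) := by
  rw [holderFactor, eval_minPolyOn_right n hab]
  simpa using eVariationOn_minPolyOn_le hn hab

/-! ### Uniqueness of the minimizer -/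

/-- An interior value occurs in two adjacent increments, whose opposite signs make the contributions
add up; hence the factor `2`. -/
lemma altSum_update {n j : ℕ} (hj : 0 < j) (hjn : j < n) (u : ℕ → ℝ) (t : ℝ) :
    altSum n (Function.update u j t) = altSum n u + 2 * (-1) ^ j * (t - u j) := by
  have h1 : Function.update u j t = fun k => u k + (t - u j) * (if k = j then 1 else 0) := by
    ext k
    by_cases h : k = j
    · subst h; simp
    · simp [h]
  have h2 : altSum n (fun k => if k = j then 1 else 0) = 2 * (-1) ^ j := by
    obtain ⟨i, rfl⟩ : ∃ i, j = i + 1 := ⟨j - 1, by omega⟩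
    simp only [altSum, mul_sub, Finset.sum_sub_distrib, mul_ite, mul_one, mul_zero,
      add_left_inj, Finset.sum_ite_eq', Finset.mem_range]
    rw [if_pos hjn, if_pos (by omega), pow_succ]
    ring
  rw [h1, altSum_add, altSum_const_mul, h2]
  ring

/-- The Chebyshev nodes already exhaust the bound. So nothing is left for `|p(b)|`, and moving one
interior node cannot raise the sum: each such node is a local extremum of `p`. -/
lemma eval_eq_zero_of_holderFactor_le {n : ℕ} (hn : 1 ≤ n) {a b : ℝ} (hab : a < b) {p : ℝ[X]}
    (hp : p.Monic) (hpn : p.natDegree = n)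
    (hle : holderFactor a b p ≤ ENNReal.ofReal (n * (b - a) ^ n / 2 ^ (2 * n - 2))) :
    p.eval b = 0 ∧ ∀ j, 0 < j → j < n → p.derivative.eval (nodeOn n a b j) = 0 := by
  have hba : 0 < b - a := by linarith
  set V : ℝ := n * (b - a) ^ n / 2 ^ (2 * n - 2) with hV
  have hV0 : 0 ≤ V := by positivity
  have hnodes : altSum n (fun k => p.eval (nodeOn n a b k)) = V := altSum_eval_nodeOn hn p hp hpn
  have hbound : ∀ y : ℕ → ℝ, AntitoneOn y (Iic n) → (∀ k ≤ n, y k ∈ Icc a b) →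
      |p.eval b| + altSum n (fun k => p.eval (y k)) ≤ V := by
    intro y hy hys
    have h1 := ofReal_altSum_le_eVariationOn (fun x => p.eval x) hy hys
    have h2 : ENNReal.ofReal (|p.eval b| + altSum n (fun k => p.eval (y k))) ≤
        ENNReal.ofReal V :=
      ENNReal.ofReal_add_le.trans ((add_le_add_right h1 _).trans hle)
    exact (ENNReal.ofReal_le_ofReal_iff hV0).mp h2
  have hanti : AntitoneOn (nodeOn n a b) (Iic n) := fun i _ j hj hij => by
    rcases hij.eq_or_lt with rfl | hij
    · rfl
    · exact (nodeOn_lt hab hj hij).le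
  refine ⟨?_, fun j hj hjn => ?_⟩
  · have := hbound _ hanti fun k _ => nodeOn_mem_Icc hab
    rw [hnodes] at this
    exact abs_eq_zero.mp (le_antisymm (by linarith) (abs_nonneg _))
  · set x := nodeOn n a b j with hx
    have hlo : nodeOn n a b (j + 1) < x := nodeOn_lt hab hjn (by omega)
    have hhi : x < nodeOn n a b (j - 1) := nodeOn_lt hab hjn.le (by omega)
    have hmax : IsLocalMax (fun t => (-1) ^ j * p.eval t) x := by
      filter_upwards [Ioo_mem_nhds hlo hhi] with t ht
      have hanti' : AntitoneOn (Function.update (nodeOn n a b) j t) (Iic n) := by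
        intro i hi k hk hik
        rw [mem_Iic] at hi hk
        by_cases hij : i = j <;> by_cases hkj : k = j
        · rw [hij, hkj]
        · subst hij
          rw [Function.update_self, Function.update_of_ne hkj]
          exact (hanti (mem_Iic.mpr (by omega : i + 1 ≤ n)) hk (by omega : i + 1 ≤ k)).trans ht.1.le
        · subst hkj
          rw [Function.update_self, Function.update_of_ne hij]
          exact ht.2.le.trans (hanti hi (mem_Iic.mpr (by omega : k - 1 ≤ n)) (by omega))
        · rw [Function.update_of_ne hij, Function.update_of_ne hkj]
          exact hanti hi hk hik
      have hmem : ∀ k ≤ n, Function.update (nodeOn n a b) j t k ∈ Icc a b := by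
        intro k _
        by_cases hkj : k = j
        · rw [hkj, Function.update_self]
          exact ⟨(nodeOn_mem_Icc hab).1.trans ht.1.le, ht.2.le.trans (nodeOn_mem_Icc hab).2⟩
        · rw [Function.update_of_ne hkj]; exact nodeOn_mem_Icc hab
      have h1 := hbound _ hanti' hmem
      have h2 : (fun k => p.eval (Function.update (nodeOn n a b) j t k)) =
          Function.update (fun k => p.eval (nodeOn n a b k)) j (p.eval t) := by
        ext k
        by_cases hkj : k = j
        · subst hkj; simp
        · simp [hkj]
      rw [h2, altSum_update hj hjn, hnodes] at h1
      have := abs_nonneg (p.eval b)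
      linarith
    have hd : HasDerivAt (fun t => (-1) ^ j * p.eval t) ((-1) ^ j * p.derivative.eval x) x :=
      (p.hasDerivAt x).const_mul _
    have := hmax.hasDerivAt_eq_zero hd
    exact (mul_eq_zero.mp this).resolve_left (by simp)

lemma eq_minPolyOn_of_holderFactor_le {n : ℕ} (hn : 1 ≤ n) {a b : ℝ} (hab : a < b) {p : ℝ[X]}
    (hp : p.Monic) (hpn : p.natDegree = n)
    (hle : holderFactor a b p ≤ ENNReal.ofReal (n * (b - a) ^ n / 2 ^ (2 * n - 2))) :
    p = minPolyOn n a b := by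
  obtain ⟨hm, hmn⟩ := minPolyOn_monic_natDegree hn hab
  obtain ⟨hp0, hp1⟩ := eval_eq_zero_of_holderFactor_le hn hab hp hpn hle
  obtain ⟨hm0, hm1⟩ :=
    eval_eq_zero_of_holderFactor_le hn hab hm hmn (holderFactor_minPolyOn_le hn hab)
  set r := p - minPolyOn n a b with hr
  have hr0 : r.eval b = 0 := by simp [hr, hp0, hm0]
  have hr1 : ∀ j, 0 < j → j < n → r.derivative.eval (nodeOn n a b j) = 0 := fun j h1 h2 => by
    simp [hr, hp1 j h1 h2, hm1 j h1 h2]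
  -- The leading terms cancel, so `r'` has degree below `n - 1` but vanishes at `n - 1` distinct
  -- nodes.
  have hder : r.derivative = 0 := by
    by_cases hrd : r.natDegree = 0
    · exact derivative_of_natDegree_zero hrd
    have hrn0 : r ≠ 0 := fun h => hrd (by simp [h])
    have hrn : r.natDegree < n := by
      have := degree_sub_lt_left (p := p) (q := minPolyOn n a b)
        (by rw [degree_eq_natDegree hp.ne_zero, degree_eq_natDegree hm.ne_zero, hpn, hmn])
        hp.ne_zero (by rw [hp.leadingCoeff, hm.leadingCoeff])
      have := natDegree_lt_natDegree hrn0 this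
      rwa [hpn] at this
    have hinj : InjOn (nodeOn n a b) (Finset.Ioo 0 n) := by
      intro i hi j hj hij
      simp only [Finset.coe_Ioo, mem_Ioo] at hi hj
      rcases lt_trichotomy i j with h | h | h
      · exact absurd hij (nodeOn_lt hab hj.2.le h).ne'
      · exact h
      · exact absurd hij (nodeOn_lt hab hi.2.le h).ne
    refine eq_zero_of_natDegree_lt_card_of_eval_eq_zero' _
      ((Finset.Ioo 0 n).image (nodeOn n a b)) ?_ ?_
    · intro x hx
      obtain ⟨j, hj, rfl⟩ := Finset.mem_image.mp hx
      rw [Finset.mem_Ioo] at hj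
      exact hr1 j hj.1 hj.2
    · rw [Finset.card_image_of_injOn hinj, Nat.card_Ioo]
      have := natDegree_derivative_lt hrd
      omega
  have hconst := eq_C_of_natDegree_eq_zero (derivative_eq_zero.mp hder)
  rw [hconst, eval_C] at hr0
  rw [hr0, C_0] at hconst
  exact sub_eq_zero.mp hconst

/-! ### Distributional derivatives and uniqueness of primitives -/

lemma locallyIntegrableOn_openInterval {a b : ℝ} {F : ℝ → ℝ} (hF : ContinuousOn F (Icc a b)) :
    LocallyIntegrableOn F (openInterval a b : Set ℝ) volume :=
  (hF.mono Ioo_subset_Icc_self).locallyIntegrableOn measurableSet_Ioo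

lemma ofFun_apply {a b : ℝ} {F : ℝ → ℝ} (hF : ContinuousOn F (Icc a b))
    (η : 𝓓(openInterval a b, ℝ)) : ofFun a b F η = ∫ x, η x * F x :=
  TestFunction.integralAgainstBilinCLM_eq_integral (B := ContinuousLinearMap.mul ℝ ℝ)
    (locallyIntegrableOn_openInterval hF)

lemma integral_mul_eq_intervalIntegral_of_tsupport_subset {a b : ℝ} (F : ℝ → ℝ)
    {η : ℝ → ℝ} (hη : tsupport η ⊆ Ioo a b) :
    ∫ x, η x * F x = ∫ x in a..b, η x * F x := by
  symm
  refine intervalIntegral.integral_eq_integral_of_support_subset fun x hx => ?_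
  have : x ∈ Function.support η := fun h => hx (by simp [h])
  exact Ioo_subset_Ioc_self (hη (subset_tsupport _ this))

lemma lineDeriv_testFunction_apply {a b : ℝ} (η : 𝓓(openInterval a b, ℝ)) (x : ℝ) :
    (∂_{(1 : ℝ)} η : 𝓓(openInterval a b, ℝ)) x = deriv η x := by
  rw [TestFunction.lineDerivOp_eq_lineDerivCLM ℝ, TestFunction.lineDerivCLM_apply_of_le (by simp)]
  rw [(η.contDiff.differentiable (by simp)).differentiableAt.lineDeriv_eq_fderiv]
  simp

lemma distDeriv_ofFun_apply {a b : ℝ} {F : ℝ → ℝ} (hF : ContinuousOn F (Icc a b))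
    (η : 𝓓(openInterval a b, ℝ)) :
    distDeriv (ofFun a b F) η = -∫ x, deriv η x * F x := by
  have : distDeriv (ofFun a b F) η = -(ofFun a b F (∂_{(1 : ℝ)} η)) := rfl
  rw [this, ofFun_apply hF]
  simp only [lineDeriv_testFunction_apply]

lemma integrable_deriv_mul {a b : ℝ} {H : ℝ → ℝ} (hH : ContinuousOn H (Icc a b))
    (η : 𝓓(openInterval a b, ℝ)) : Integrable (fun x => deriv η x * H x) := by
  have h := TestFunction.integrable_bilin (ContinuousLinearMap.mul ℝ ℝ)
    (locallyIntegrableOn_openInterval hH) (∂_{(1 : ℝ)} η : 𝓓(openInterval a b, ℝ))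
  simp only [lineDeriv_testFunction_apply] at h
  exact h

lemma distDeriv_ofFun {a b : ℝ} (hab : a < b) {F F' : ℝ → ℝ} (hF : ContinuousOn F (Icc a b))
    (hF' : ContinuousOn F' (Icc a b)) (hd : ∀ x ∈ Ioo a b, HasDerivAt F (F' x) x) :
    distDeriv (ofFun a b F) = ofFun a b F' := by
  ext η
  have hηd : ∀ x, HasDerivAt η (deriv η x) x := fun x =>
    (η.contDiff.differentiable (by simp)).differentiableAt.hasDerivAt
  have hη' : Continuous (deriv η) := η.contDiff.continuous_deriv (by simp)
  have hsupp : tsupport η ⊆ Ioo a b := η.tsupport_subset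
  have hz : ∀ x, x ∉ Ioo a b → η x = 0 := fun x hx =>
    image_eq_zero_of_notMem_tsupport fun h => hx (hsupp h)
  rw [distDeriv_ofFun_apply hF, ofFun_apply hF', integral_mul_eq_intervalIntegral_of_tsupport_subset F'
    hsupp, integral_mul_eq_intervalIntegral_of_tsupport_subset F ((tsupport_deriv_subset).trans hsupp)]
  have := intervalIntegral.integral_mul_deriv_eq_deriv_mul_of_hasDerivAt
    (u := η) (v := F) (u' := deriv η) (v' := F') (a := a) (b := b)
    η.continuous.continuousOn (by rwa [uIcc_of_le hab.le])
    (fun x _ => hηd x) (by rwa [min_eq_left hab.le, max_eq_right hab.le])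
    (hη'.intervalIntegrable _ _)
    (ContinuousOn.intervalIntegrable (by rwa [uIcc_of_le hab.le]))
  rw [this, hz a (by simp), hz b (by simp)]
  simp

lemma exists_Icc_of_isCompact {a b : ℝ} (hab : a < b) {K : Set ℝ} (hK : IsCompact K)
    (hKs : K ⊆ Ioo a b) : ∃ c d, a < c ∧ c ≤ d ∧ d < b ∧ K ⊆ Icc c d := by
  rcases K.eq_empty_or_nonempty with rfl | hne
  · exact ⟨(a + b) / 2, (a + b) / 2, by linarith, le_rfl, by linarith, empty_subset _⟩
  · exact ⟨sInf K, sSup K, (hKs (hK.sInf_mem hne)).1,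
      csInf_le_csSup hne hK.bddBelow hK.bddAbove, (hKs (hK.sSup_mem hne)).2,
      fun x hx => ⟨csInf_le hK.bddBelow hx, le_csSup hK.bddAbove hx⟩⟩

/-- A test function with vanishing integral is the derivative of a test function. -/
lemma exists_testFunction_deriv_eq {a b : ℝ} (hab : a < b) {ψ : ℝ → ℝ}
    (hψ : ContDiff ℝ ((⊤ : ℕ∞) : WithTop ℕ∞) ψ) (hc : HasCompactSupport ψ)
    (hs : tsupport ψ ⊆ Ioo a b) (h0 : ∫ x, ψ x = 0) :
    ∃ η : 𝓓(openInterval a b, ℝ), deriv η = ψ := by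
  obtain ⟨c, d, hac, hcd, hdb, hK⟩ := exists_Icc_of_isCompact hab hc hs
  have hz : ∀ x, x ∉ Icc c d → ψ x = 0 := fun x hx =>
    image_eq_zero_of_notMem_tsupport fun h => hx (hK h)
  set Φ : ℝ → ℝ := fun x => ∫ t in a..x, ψ t with hΦ
  have hd : ∀ x, HasDerivAt Φ (ψ x) x := fun x =>
    intervalIntegral.integral_hasDerivAt_right (hψ.continuous.intervalIntegrable _ _)
      (hψ.continuous.stronglyMeasurableAtFilter _ _) hψ.continuous.continuousAt
  have hderiv : deriv Φ = ψ := funext fun x => (hd x).deriv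
  have hΦs : ContDiff ℝ ((⊤ : ℕ∞) : WithTop ℕ∞) Φ := by
    rw [contDiff_infty_iff_deriv, hderiv]
    exact ⟨fun x => (hd x).differentiableAt, hψ⟩
  have hleft : ∀ x < c, Φ x = 0 := by
    intro x hx
    refine intervalIntegral.integral_zero_ae (Filter.Eventually.of_forall fun t ht => hz t ?_)
    intro htc
    have := ht.2
    exact absurd (this.trans_lt (max_lt hac hx)) (not_lt.mpr htc.1)
  -- To the right of the support `Φ` equals the full integral of `ψ`; this is where `h0` makes the
  -- support compact.
  have hright : ∀ x, d < x → Φ x = 0 := by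
    intro x hx
    rw [hΦ, ← h0]
    refine intervalIntegral.integral_eq_integral_of_support_subset fun t ht => ?_
    have := by_contra fun h => ht (hz t h)
    exact ⟨hac.trans_le this.1, this.2.trans hx.le⟩
  have hΦK : Function.support Φ ⊆ Icc c d := fun x hx => by
    by_contra h
    rw [mem_Icc, not_and_or, not_le, not_le] at h
    exact hx (h.elim (hleft x) (hright x))
  have hts : tsupport Φ ⊆ Icc c d := closure_minimal hΦK isClosed_Icc
  exact ⟨⟨Φ, hΦs, HasCompactSupport.of_support_subset_isCompact isCompact_Icc hΦK,
    hts.trans (Icc_subset_Ioo hac hdb)⟩, hderiv⟩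

/-- **du Bois-Reymond's lemma**. -/
lemma eqOn_const_of_forall_integral_deriv_mul_eq_zero {a b : ℝ} (hab : a < b) {h : ℝ → ℝ}
    (hh : ContinuousOn h (Icc a b))
    (h0 : ∀ η : 𝓓(openInterval a b, ℝ), ∫ x, deriv η x * h x = 0) :
    ∃ c : ℝ, EqOn h (fun _ => c) (Icc a b) := by
  have hloc : LocallyIntegrableOn h (Ioo a b) volume := locallyIntegrableOn_openInterval hh
  let ρ : ContDiffBump ((a + b) / 2) :=
    ⟨(b - a) / 8, (b - a) / 4, by linarith, by linarith⟩
  set r : ℝ → ℝ := ρ.normed volume with hr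
  have hrs : ContDiff ℝ ((⊤ : ℕ∞) : WithTop ℕ∞) r := ρ.contDiff_normed
  have hrc : HasCompactSupport r := ρ.hasCompactSupport_normed
  have hrt : tsupport r ⊆ Ioo a b := by
    rw [hr, ρ.tsupport_normed_eq, Real.closedBall_eq_Icc]
    refine Icc_subset_Ioo ?_ ?_ <;> simp only [ρ] <;> linarith
  have hr1 : ∫ x, r x = 1 := ρ.integral_normed
  have hint : ∀ g : ℝ → ℝ, ContDiff ℝ ((⊤ : ℕ∞) : WithTop ℕ∞) g → HasCompactSupport g →
      tsupport g ⊆ Ioo a b → Integrable (fun x => g x * h x) := fun g hg hgc hgt =>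
    TestFunction.integrable_bilin (Ω := openInterval a b) (ContinuousLinearMap.mul ℝ ℝ) hloc
      (⟨g, hg, hgc, hgt⟩ : 𝓓(openInterval a b, ℝ))
  set c : ℝ := ∫ x, r x * h x with hc
  have hae : ∀ᵐ x, x ∈ Ioo a b → h x - c = 0 := by
    refine isOpen_Ioo.ae_eq_zero_of_integral_contDiff_smul_eq_zero
      (hloc.sub (locallyIntegrableOn_const c)) fun g hg hgc hgt => ?_
    have hgi : Integrable g := hg.continuous.integrable_of_hasCompactSupport hgc
    have hri : Integrable r := hrs.continuous.integrable_of_hasCompactSupport hrc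
    set s : ℝ := ∫ x, g x with hs
    -- Since `r` has mass `1`, subtracting `s * r` makes the integral zero. Testing `h` on the
    -- result shows `∫ g h = s c`, so `c` is the constant sought.
    obtain ⟨η, hη⟩ := exists_testFunction_deriv_eq hab (ψ := fun x => g x - s * r x)
      (hg.sub (contDiff_const.mul hrs)) (hgc.sub hrc.mul_left)
      ((tsupport_sub g _).trans (union_subset hgt ((tsupport_mul_subset_right).trans hrt)))
      (by rw [integral_sub hgi (hri.const_mul s), integral_const_mul, hr1, mul_one, sub_self])
    have h1 := h0 η
    simp only [hη, sub_mul, mul_assoc] at h1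
    rw [integral_sub (hint g hg hgc hgt) ((hint r hrs hrc hrt).const_mul s),
      integral_const_mul] at h1
    simp only [smul_eq_mul, mul_sub]
    rw [integral_sub (hint g hg hgc hgt) (hgi.mul_const c), integral_mul_const]
    linarith
  refine ⟨c, Measure.eqOn_Icc_of_ae_eq volume hab.ne ?_ hh continuousOn_const⟩
  rw [Filter.EventuallyEq, ← Measure.restrict_congr_set Ioo_ae_eq_Icc,
    ae_restrict_iff' measurableSet_Ioo]
  filter_upwards [hae] with x hx hxI
  linarith [hx hxI]

/-- The difference is constant by du Bois-Reymond and vanishes at `a`. Thus the choices in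
`cpIntegral` and `cpIntegralMul` do no harm. -/
lemma IsPrimitive.eqOn {a b : ℝ} (hab : a < b) {T : 𝓓'(openInterval a b, ℝ)} {F G : ℝ → ℝ}
    (hF : IsPrimitive F T) (hG : IsPrimitive G T) : EqOn F G (Icc a b) := by
  obtain ⟨c, hc⟩ := eqOn_const_of_forall_integral_deriv_mul_eq_zero hab (hF.1.sub hG.1)
    (fun η => by
      have h1 := distDeriv_ofFun_apply hF.1 η
      have h2 := distDeriv_ofFun_apply hG.1 η
      rw [hF.2.2] at h1
      rw [hG.2.2] at h2
      simp only [Pi.sub_apply, mul_sub]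
      rw [integral_sub (integrable_deriv_mul hF.1 η) (integrable_deriv_mul hG.1 η)]
      linarith)
  have ha := hc (left_mem_Icc.mpr hab.le)
  simp only [Pi.sub_apply, hF.2.1, hG.2.1, sub_zero] at ha
  intro x hx
  have := hc hx
  simp only [Pi.sub_apply] at this
  linarith

lemma IsPrimitive.alexNorm_eq {a b : ℝ} (hab : a < b) {T : 𝓓'(openInterval a b, ℝ)} {F : ℝ → ℝ}
    (hF : IsPrimitive F T) : alexNorm T = sSup ((fun x => |F x|) '' Icc a b) := by
  have hex : ∃ F : ℝ → ℝ, IsPrimitive F T := ⟨F, hF⟩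
  have h : EqOn (cpIntegral T) F (Icc a b) := by
    rw [cpIntegral, dif_pos hex]
    exact hex.choose_spec.eqOn hab hF
  rw [alexNorm, image_congr fun x hx => by rw [h hx]]

/-- The first `n - 1` distributional derivatives are classical; only the last is not, and it ignores
the subtracted constant. -/
lemma isPrimitive_distDerivFun {n : ℕ} (hn : 1 ≤ n) {a b : ℝ} (hab : a < b) {f : ℝ → ℝ}
    (hf : ContDiffOn ℝ ((n - 1 : ℕ) : WithTop ℕ∞) f (Icc a b)) :
    IsPrimitive (fun x => iteratedDerivWithin (n - 1) f (Icc a b) x -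
      iteratedDerivWithin (n - 1) f (Icc a b) a) (distDerivFun n a b f) := by
  have hu := uniqueDiffOn_Icc hab
  have hcont : ∀ k ≤ n - 1, ContinuousOn (iteratedDerivWithin k f (Icc a b)) (Icc a b) :=
    fun k hk => hf.continuousOn_iteratedDerivWithin (by exact_mod_cast hk) hu
  have hiter : ∀ k ≤ n - 1, distDeriv^[k] (ofFun a b f) =
      ofFun a b (iteratedDerivWithin k f (Icc a b)) := by
    intro k
    induction k with
    | zero => intro _; simp [iteratedDerivWithin_zero]
    | succ k ih =>
      intro hk
      rw [Function.iterate_succ_apply', ih (by omega)]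
      refine distDeriv_ofFun hab (hcont k (by omega)) (hcont (k + 1) hk) fun x hx => ?_
      have hd := (hf.differentiableOn_iteratedDerivWithin (m := k)
        (by exact_mod_cast (by omega : k < n - 1)) hu) x (Ioo_subset_Icc_self hx)
      rw [iteratedDerivWithin_succ]
      exact hd.hasDerivWithinAt.hasDerivAt (Icc_mem_nhds hx.1 hx.2)
  have hc := hcont (n - 1) le_rfl
  have hcK : ContinuousOn (fun x => iteratedDerivWithin (n - 1) f (Icc a b) x -
      iteratedDerivWithin (n - 1) f (Icc a b) a) (Icc a b) := hc.sub continuousOn_const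
  refine ⟨hcK, sub_self _, ?_⟩
  have hsucc : distDerivFun n a b f =
      distDeriv (ofFun a b (iteratedDerivWithin (n - 1) f (Icc a b))) := by
    obtain ⟨m, rfl⟩ : ∃ m, n = m + 1 := ⟨n - 1, by omega⟩
    rw [← hiter _ le_rfl, distDerivFun, Function.iterate_succ_apply']
    rfl
  rw [hsucc]
  ext η
  set K := iteratedDerivWithin (n - 1) f (Icc a b) a
  rw [distDeriv_ofFun_apply hcK, distDeriv_ofFun_apply hc]
  have hz : ∫ x, deriv η x * K = 0 := by
    have h1 := distDeriv_ofFun_apply (a := a) (b := b) (F := fun _ => K) continuousOn_const η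
    rw [distDeriv_ofFun hab (F' := fun _ => 0) continuousOn_const continuousOn_const
      (fun x _ => hasDerivAt_const x K), ofFun_apply continuousOn_const] at h1
    simpa using h1.symm
  simp only [mul_sub]
  rw [integral_sub (integrable_deriv_mul hc η)
    (integrable_deriv_mul continuousOn_const η), hz, sub_zero]

/-! ### Riemann–Stieltjes integrals -/

/-- The `i`-th point of the partition of `[a, b]` into `N + 1` equal parts. -/
def uniformPoint (a b : ℝ) (N i : ℕ) : ℝ := a + i * ((b - a) / (N + 1))

lemma uniformPoint_monotone {a b : ℝ} (hab : a ≤ b) (N : ℕ) : Monotone (uniformPoint a b N) := by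
  intro i j hij
  have : 0 ≤ b - a := by linarith
  simp only [uniformPoint]
  gcongr

lemma uniformPoint_last (a b : ℝ) (N : ℕ) : uniformPoint a b N (N + 1) = b := by
  simp only [uniformPoint]
  push_cast
  have : (N : ℝ) + 1 ≠ 0 := by positivity
  field_simp
  ring

lemma uniformPoint_mem_Icc {a b : ℝ} (hab : a ≤ b) {N i : ℕ} (hi : i ≤ N + 1) :
    uniformPoint a b N i ∈ Icc a b := by
  refine ⟨?_, ?_⟩
  · simpa [uniformPoint] using uniformPoint_monotone hab N (Nat.zero_le i)
  · simpa [uniformPoint_last] using uniformPoint_monotone hab N hi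

/-- The Riemann–Stieltjes sums over the uniform partitions, tagged at the left end points,
converge to the integral. -/
lemma HasRSIntegral.tendsto {a b : ℝ} (hab : a ≤ b) {F g : ℝ → ℝ} {I : ℝ}
    (h : HasRSIntegral a b F g I) :
    Filter.Tendsto (fun N => ∑ i ∈ Finset.range (N + 1), F (uniformPoint a b N i) *
      (g (uniformPoint a b N (i + 1)) - g (uniformPoint a b N i))) Filter.atTop (nhds I) := by
  rw [Metric.tendsto_atTop]
  intro ε hε
  obtain ⟨δ, hδ, hsum⟩ := h ε hε
  obtain ⟨N₀, hN₀⟩ := exists_nat_gt ((b - a) / δ)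
  refine ⟨N₀, fun N hN => ?_⟩
  have hmono := uniformPoint_monotone hab N
  rw [Real.dist_eq]
  refine hsum (N + 1) (uniformPoint a b N) (uniformPoint a b N) hmono (by simp [uniformPoint])
    (uniformPoint_last a b N) (fun i _ => ?_)
    (fun i _ => ⟨le_rfl, hmono (Nat.le_succ i)⟩)
  have : uniformPoint a b N (i + 1) - uniformPoint a b N i = (b - a) / (N + 1) := by
    simp only [uniformPoint]; push_cast; ring
  rw [this, div_lt_iff₀ (by positivity)]
  rw [div_lt_iff₀ hδ] at hN₀
  have : (N₀ : ℝ) ≤ N := by exact_mod_cast hN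
  nlinarith

lemma HasRSIntegral.unique {a b : ℝ} (hab : a ≤ b) {F G g : ℝ → ℝ} {I J : ℝ}
    (hF : HasRSIntegral a b F g I) (hG : HasRSIntegral a b G g J) (h : EqOn F G (Icc a b)) :
    I = J := by
  refine tendsto_nhds_unique (hF.tendsto hab) ((hG.tendsto hab).congr fun N => ?_)
  refine Finset.sum_congr rfl fun i hi => ?_
  rw [h (uniformPoint_mem_Icc hab (Finset.mem_range.mp hi).le)]

lemma HasRSIntegral.abs_le {a b : ℝ} (hab : a ≤ b) {F g : ℝ → ℝ} {I M V : ℝ}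
    (hF : HasRSIntegral a b F g I) (hM : ∀ x ∈ Icc a b, |F x| ≤ M) (hV0 : 0 ≤ V)
    (hV : eVariationOn g (Icc a b) ≤ ENNReal.ofReal V) : |I| ≤ M * V := by
  have hM0 : 0 ≤ M := (abs_nonneg _).trans (hM a ⟨le_rfl, hab⟩)
  refine le_of_tendsto (hF.tendsto hab).abs (Filter.Eventually.of_forall fun N => ?_)
  set x := uniformPoint a b N with hx
  have hvar : ∑ i ∈ Finset.range (N + 1), |g (x (i + 1)) - g (x i)| ≤ V := by
    have := (eVariationOn.sum_le_of_monotoneOn_Iic (f := g) (n := N + 1)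
      ((uniformPoint_monotone hab N).monotoneOn _)
      (fun i hi => uniformPoint_mem_Icc hab hi)).trans hV
    simp only [edist_dist, Real.dist_eq] at this
    rw [← ENNReal.ofReal_sum_of_nonneg fun _ _ => abs_nonneg _] at this
    exact (ENNReal.ofReal_le_ofReal_iff hV0).mp this
  calc _ ≤ ∑ i ∈ Finset.range (N + 1), |F (x i) * (g (x (i + 1)) - g (x i))| :=
        Finset.abs_sum_le_sum_abs _ _
    _ ≤ ∑ i ∈ Finset.range (N + 1), M * |g (x (i + 1)) - g (x i)| := by
        refine Finset.sum_le_sum fun i hi => ?_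
        rw [abs_mul]
        gcongr
        exact hM _ (uniformPoint_mem_Icc hab (Finset.mem_range.mp hi).le)
    _ ≤ M * V := by rw [← Finset.mul_sum]; gcongr

/-- The Riemann–Stieltjes integral with respect to a polynomial. -/
lemma hasRSIntegral_eval {a b : ℝ} (hab : a < b) {F : ℝ → ℝ} (hF : ContinuousOn F (Icc a b))
    (p : ℝ[X]) :
    HasRSIntegral a b F (fun x => p.eval x) (∫ x in a..b, F x * p.derivative.eval x) := by
  intro ε hε
  obtain ⟨M₀, hM₀⟩ := isCompact_Icc.exists_bound_of_continuousOn
    (s := Icc a b) p.derivative.continuous.continuousOn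
  -- The maximum with `1` makes `M` positive, as the division in `ε'` requires; the total error will
  -- be `ε' M (b-a) = ε/2`.
  set M := max M₀ 1 with hMdef
  have hM : ∀ x ∈ Icc a b, |p.derivative.eval x| ≤ M := fun x hx =>
    (hM₀ x hx).trans (le_max_left _ _)
  have hM0 : 0 < M := lt_of_lt_of_le one_pos (le_max_right _ _)
  have hba : 0 < b - a := by linarith
  set ε' := ε / (2 * (M * (b - a))) with hε'
  have hε'0 : 0 < ε' := by positivity
  have huc := isCompact_Icc.uniformContinuousOn_of_continuous hF
  obtain ⟨δ, hδ, hF'⟩ := Metric.uniformContinuousOn_iff.mp huc ε' hε'0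
  refine ⟨δ, hδ, fun N x t hx hx0 hxN hmesh ht => ?_⟩
  have hxmem : ∀ i ≤ N, x i ∈ Icc a b := fun i hi => ⟨hx0 ▸ hx (Nat.zero_le i), hxN ▸ hx hi⟩
  have hpc : Continuous fun s => p.derivative.eval s := p.derivative.continuous
  have hcont : ContinuousOn (fun s => F s * p.derivative.eval s) (Icc a b) :=
    hF.mul hpc.continuousOn
  have hsub : ∀ i < N, uIcc (x i) (x (i + 1)) ⊆ Icc a b := fun i hi => by
    rw [uIcc_of_le (hx (Nat.le_succ i))]
    exact Icc_subset_Icc (hxmem i hi.le).1 (hxmem (i + 1) hi).2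
  have hint : ∀ i < N, IntervalIntegrable (fun s => F s * p.derivative.eval s) volume
      (x i) (x (i + 1)) := fun i hi => (hcont.mono (hsub i hi)).intervalIntegrable
  have hterm : ∀ i < N, |F (t i) * (p.eval (x (i + 1)) - p.eval (x i)) -
      ∫ s in x i..x (i + 1), F s * p.derivative.eval s| ≤ ε' * M * (x (i + 1) - x i) := by
    intro i hi
    have hftc : p.eval (x (i + 1)) - p.eval (x i) =
        ∫ s in x i..x (i + 1), p.derivative.eval s :=
      (intervalIntegral.integral_eq_sub_of_hasDerivAt (fun s _ => p.hasDerivAt s)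
        (hpc.intervalIntegrable _ _)).symm
    rw [hftc, ← intervalIntegral.integral_const_mul, ← intervalIntegral.integral_sub
      ((hpc.intervalIntegrable _ _).const_mul (F (t i))) (hint i hi)]
    have hle := hx (Nat.le_succ i)
    have := intervalIntegral.norm_integral_le_of_norm_le_const
      (a := x i) (b := x (i + 1)) (C := ε' * M)
      (f := fun s => F (t i) * p.derivative.eval s - F s * p.derivative.eval s) (fun s hs => by
        rw [uIoc_of_le hle] at hs
        have hs' : s ∈ Icc a b := hsub i hi (by
          rw [uIcc_of_le hle]; exact Ioc_subset_Icc_self hs)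
        have hti := ht i hi
        have hti' : t i ∈ Icc a b := hsub i hi (by rw [uIcc_of_le hle]; exact hti)
        have hm := hmesh i hi
        have hd : dist (t i) s < δ := by
          rw [Real.dist_eq, abs_lt]
          constructor <;> linarith [hs.1, hs.2, hti.1, hti.2]
        have := hF' _ hti' _ hs' hd
        rw [Real.dist_eq] at this
        rw [← sub_mul, Real.norm_eq_abs, abs_mul]
        exact mul_le_mul this.le (hM s hs') (abs_nonneg _) hε'0.le)
    rwa [Real.norm_eq_abs, abs_of_nonneg (sub_nonneg.mpr hle)] at this
  have htot := intervalIntegral.sum_integral_adjacent_intervals hint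
  rw [hx0, hxN] at htot
  rw [← htot, ← Finset.sum_sub_distrib]
  calc _ ≤ ∑ i ∈ Finset.range N, |F (t i) * (p.eval (x (i + 1)) - p.eval (x i)) -
          ∫ s in x i..x (i + 1), F s * p.derivative.eval s| := Finset.abs_sum_le_sum_abs _ _
    _ ≤ ∑ i ∈ Finset.range N, ε' * M * (x (i + 1) - x i) :=
        Finset.sum_le_sum fun i hi => hterm i (Finset.mem_range.mp hi)
    _ = ε' * M * (b - a) := by
        rw [← Finset.mul_sum, Finset.sum_range_sub, hx0, hxN]
    _ = ε / 2 := by rw [hε']; field_simp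
    _ < ε := by linarith

/-! ### The error functional and its bound -/

lemma IsPrimitive.hasCPIntegralMul {a b : ℝ} (hab : a < b) {T : 𝓓'(openInterval a b, ℝ)}
    {F : ℝ → ℝ} (hF : IsPrimitive F T) (p : ℝ[X]) :
    HasCPIntegralMul T (fun x => p.eval x)
      (F b * p.eval b - ∫ x in a..b, F x * p.derivative.eval x) :=
  ⟨F, hF, _, hasRSIntegral_eval hab hF.1 p, by rw [hF.2.1]; ring⟩

lemma IsPrimitive.cpIntegralMul_eq {a b : ℝ} (hab : a < b) {T : 𝓓'(openInterval a b, ℝ)}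
    {F : ℝ → ℝ} (hF : IsPrimitive F T) (p : ℝ[X]) :
    cpIntegralMul T (fun x => p.eval x) =
      F b * p.eval b - ∫ x in a..b, F x * p.derivative.eval x := by
  have hex : ∃ I, HasCPIntegralMul T (fun x => p.eval x) I := ⟨_, hF.hasCPIntegralMul hab p⟩
  rw [cpIntegralMul, dif_pos hex]
  obtain ⟨G, hG, J, hJ, hI⟩ := hex.choose_spec
  have hGF := hG.eqOn hab hF
  rw [hI, hJ.unique hab.le (hasRSIntegral_eval hab hF.1 p) hGF,
    hGF (right_mem_Icc.mpr hab.le), hG.2.1]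
  ring

/-- The normalization `T_n - 1` pays off here: `φ_n(b) = 0` removes the boundary term. -/
lemma quadError_eq {n : ℕ} (hn : 1 ≤ n) {a b : ℝ} (hab : a < b) {f : ℝ → ℝ}
    (hf : ContDiffOn ℝ ((n - 1 : ℕ) : WithTop ℕ∞) f (Icc a b)) :
    quadError n a b f = (-1) ^ n / (n ! : ℝ) *
      -∫ x in a..b, (iteratedDerivWithin (n - 1) f (Icc a b) x -
        iteratedDerivWithin (n - 1) f (Icc a b) a) * (minPolyOn n a b).derivative.eval x := by
  rw [quadError, (isPrimitive_distDerivFun hn hab hf).cpIntegralMul_eq hab,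
    eval_minPolyOn_right n hab]
  simp

lemma abs_quadError_le {n : ℕ} (hn : 1 ≤ n) {a b : ℝ} (hab : a < b) {f : ℝ → ℝ}
    (hf : ContDiffOn ℝ ((n - 1 : ℕ) : WithTop ℕ∞) f (Icc a b)) :
    |quadError n a b f| ≤ alexNorm (distDerivFun n a b f) * (b - a) ^ n /
      (((n - 1)! : ℝ) * 2 ^ (2 * n - 2)) := by
  have hF := isPrimitive_distDerivFun hn hab hf
  have hba : 0 < b - a := by linarith
  rw [quadError_eq hn hab hf, hF.alexNorm_eq hab]
  set F : ℝ → ℝ := fun x => iteratedDerivWithin (n - 1) f (Icc a b) x -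
    iteratedDerivWithin (n - 1) f (Icc a b) a
  set M := sSup ((fun x => |F x|) '' Icc a b)
  have hbdd : BddAbove ((fun x => |F x|) '' Icc a b) :=
    (isCompact_Icc.image_of_continuousOn hF.1.abs).bddAbove
  have hle := (hasRSIntegral_eval hab hF.1 (minPolyOn n a b)).abs_le hab.le
    (fun x hx => le_csSup hbdd (mem_image_of_mem _ hx)) (by positivity)
    (eVariationOn_minPolyOn_le hn hab)
  rw [abs_mul, abs_neg, abs_div, abs_pow, abs_neg, abs_one, one_pow, Nat.abs_cast]
  refine (mul_le_mul_of_nonneg_left hle (by positivity)).trans (le_of_eq ?_)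
  obtain ⟨m, rfl⟩ : ∃ m, n = m + 1 := ⟨n - 1, by omega⟩
  rw [Nat.add_sub_cancel, Nat.factorial_succ]
  push_cast
  field_simp
  rfl

/-! ### The quadrature formula -/

/-- Repeated integration by parts against a polynomial. -/
lemma integral_iteratedDerivWithin_mul_eval {a b : ℝ} (hab : a < b) {f : ℝ → ℝ} (m : ℕ)
    (hf : ContDiffOn ℝ (m : WithTop ℕ∞) f (Icc a b)) (q : ℝ[X]) :
    ∫ x in a..b, iteratedDerivWithin m f (Icc a b) x * q.eval x =
      ∑ k ∈ Finset.range m, (-1) ^ (m - 1 - k) *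
        (iteratedDerivWithin k f (Icc a b) b * (derivative^[m - 1 - k] q).eval b -
          iteratedDerivWithin k f (Icc a b) a * (derivative^[m - 1 - k] q).eval a) +
      (-1) ^ m * ∫ x in a..b, f x * (derivative^[m] q).eval x := by
  have hu := uniqueDiffOn_Icc hab
  induction m generalizing q with
  | zero => simp [iteratedDerivWithin_zero]
  | succ m ih =>
    have hcont : ∀ k ≤ m + 1, ContinuousOn (iteratedDerivWithin k f (Icc a b)) (uIcc a b) := by
      rw [uIcc_of_le hab.le]
      exact fun k hk => hf.continuousOn_iteratedDerivWithin (by exact_mod_cast hk) hu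
    have hparts := intervalIntegral.integral_mul_deriv_eq_deriv_mul_of_hasDerivAt
      (u := fun x => q.eval x) (v := iteratedDerivWithin m f (Icc a b))
      (u' := fun x => q.derivative.eval x) (v' := iteratedDerivWithin (m + 1) f (Icc a b))
      (a := a) (b := b) q.continuous.continuousOn (hcont m (by omega))
      (fun x _ => q.hasDerivAt x) (fun x hx => by
        rw [min_eq_left hab.le, max_eq_right hab.le] at hx
        have hd := (hf.differentiableOn_iteratedDerivWithin (m := m)
          (by exact_mod_cast Nat.lt_succ_self m) hu) x (Ioo_subset_Icc_self hx)
        rw [iteratedDerivWithin_succ]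
        exact hd.hasDerivWithinAt.hasDerivAt (Icc_mem_nhds hx.1 hx.2))
      (q.derivative.continuous.intervalIntegrable _ _) (hcont (m + 1) le_rfl).intervalIntegrable
    have ih := ih (hf.of_le (by exact_mod_cast Nat.le_succ m)) q.derivative
    simp only [mul_comm (eval _ q), mul_comm (eval _ (derivative q))] at hparts
    rw [hparts, ih, Finset.sum_range_succ]
    have hsum : ∀ k ∈ Finset.range m, (-1 : ℝ) ^ (m + 1 - 1 - k) *
        (iteratedDerivWithin k f (Icc a b) b * (derivative^[m + 1 - 1 - k] q).eval b -
          iteratedDerivWithin k f (Icc a b) a * (derivative^[m + 1 - 1 - k] q).eval a) =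
        -((-1) ^ (m - 1 - k) *
        (iteratedDerivWithin k f (Icc a b) b * (derivative^[m - 1 - k] (derivative q)).eval b -
        iteratedDerivWithin k f (Icc a b) a * (derivative^[m - 1 - k] (derivative q)).eval a)) := by
      intro k hk
      rw [Finset.mem_range] at hk
      have e : m + 1 - 1 - k = m - 1 - k + 1 := by omega
      rw [e, Function.iterate_succ_apply, pow_succ]
      ring
    rw [Finset.sum_congr rfl hsum, Finset.sum_neg_distrib, Function.iterate_succ_apply]
    simp only [Nat.add_sub_cancel, Nat.sub_self, pow_zero, Function.iterate_zero, id_eq, pow_succ]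
    ring

lemma iterate_derivative_natDegree_of_monic {p : ℝ[X]} (hp : p.Monic) {n : ℕ}
    (hn : p.natDegree = n) : derivative^[n] p = C (n ! : ℝ) := by
  ext k
  rw [coeff_iterate_derivative, coeff_C]
  split_ifs with hk
  · subst hk
    rw [zero_add, Nat.descFactorial_self, ← hn, coeff_natDegree, hp.leadingCoeff]
    simp
  · rw [coeff_eq_zero_of_natDegree_lt (by omega)]
    simp

/-- This yields the weight of the `k`-th derivative for `n = m + k + 1`, a form free of natural
subtraction. -/
lemma eval_iterate_derivative_minPolyOn_right {m k : ℕ} (hm : 1 ≤ m) {a b : ℝ} (hab : a < b) :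
    (derivative^[m] (minPolyOn (m + k + 1) a b)).eval b / ((m + k + 1)! : ℝ) =
      1 / ((m + k)! : ℝ) * ((b - a) ^ (k + 1) * ((2 * m + k)! : ℝ) * (m ! : ℝ) /
        (2 ^ (2 * k + 1) * ((2 * m)! : ℝ) * ((k + 1)! : ℝ))) := by
  have hba : b - a ≠ 0 := by linarith
  have hD := iterate_derivative_T_eval_one_mul_factorial (n := m + k + 1) (m := m)
    (by omega) (by omega)
  have hs := minPolyScale_eq (n := m + k + 1) (by omega) a b
  have e1 : m + k + 1 - m = k + 1 := by omega
  have e2 : m + k + 1 + m - 1 = 2 * m + k := by omega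
  have e3 : 2 * (m + k + 1) - 2 = m + m + 2 * k := by omega
  rw [e1, e2] at hD
  rw [e3] at hs
  rw [eval_iterate_derivative_minPolyOn _ hm, affine_right hab]
  set D := eval 1 (derivative^[m] (Chebyshev.T ℝ ((m + k + 1 : ℕ) : ℤ)))
  have hD' : D = ((m + k + 1 : ℕ) : ℝ) * ((2 * m + k)! : ℝ) * 2 ^ m * (m ! : ℝ) /
      (((k + 1)! : ℝ) * ((2 * m)! : ℝ)) := by
    rw [eq_div_iff (by positivity)]; exact hD
  have hs' : minPolyScale (m + k + 1) a b = (b - a) ^ (m + k + 1) / 2 ^ (m + m + 2 * k) / 2 := by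
    linarith
  rw [hD', hs', Nat.factorial_succ (m + k), div_pow]
  push_cast
  have h1 : ((m : ℝ) + k + 1) ≠ 0 := by positivity
  have h2 : ((m + k)! : ℝ) ≠ 0 := by positivity
  have h3 : ((2 * m)! : ℝ) ≠ 0 := by positivity
  have h4 : ((k + 1)! : ℝ) ≠ 0 := by positivity
  field_simp
  ring

lemma eval_iterate_derivative_minPolyOn_left {n m : ℕ} (hm : 1 ≤ m) {a b : ℝ} (hab : a < b) :
    (derivative^[m] (minPolyOn n a b)).eval a =
      (-1) ^ (n + m) * (derivative^[m] (minPolyOn n a b)).eval b := by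
  rw [eval_iterate_derivative_minPolyOn _ hm, eval_iterate_derivative_minPolyOn _ hm,
    affine_left hab, affine_right hab, iterate_derivative_T_eval_neg_one]
  ring

lemma integral_eq_quadRule_add_quadError {n : ℕ} (hn : 1 ≤ n) {a b : ℝ} (hab : a < b) {f : ℝ → ℝ}
    (hf : ContDiffOn ℝ ((n - 1 : ℕ) : WithTop ℕ∞) f (Icc a b)) :
    ∫ x in a..b, f x = quadRule n a b f + quadError n a b f := by
  obtain ⟨hmon, hdeg⟩ := minPolyOn_monic_natDegree hn hab
  set p := minPolyOn n a b with hp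
  set K := iteratedDerivWithin (n - 1) f (Icc a b) a with hK
  have hc : ContinuousOn (iteratedDerivWithin (n - 1) f (Icc a b)) (uIcc a b) := by
    rw [uIcc_of_le hab.le]
    exact hf.continuousOn_iteratedDerivWithin le_rfl (uniqueDiffOn_Icc hab)
  have hpc : Continuous fun x => p.derivative.eval x := p.derivative.continuous
  -- Because `φ_n(b) = 0`, subtracting `K` costs only `K φ_n(a)`, the source of the term `R_n`.
  have hint : ∫ x in a..b, (iteratedDerivWithin (n - 1) f (Icc a b) x - K) * p.derivative.eval x =
      (∫ x in a..b, iteratedDerivWithin (n - 1) f (Icc a b) x * p.derivative.eval x) +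
        K * p.eval a := by
    have hi : IntervalIntegrable (fun x => iteratedDerivWithin (n - 1) f (Icc a b) x *
        p.derivative.eval x) volume a b := (hc.mul hpc.continuousOn).intervalIntegrable
    simp only [sub_mul]
    rw [intervalIntegral.integral_sub hi
      ((hpc.intervalIntegrable _ _).const_mul K), intervalIntegral.integral_const_mul,
      intervalIntegral.integral_eq_sub_of_hasDerivAt (fun s _ => p.hasDerivAt s)
        (hpc.intervalIntegrable _ _), hp, eval_minPolyOn_right n hab]
    ring
  have hiter : ∀ x, (derivative^[n - 1] (derivative p)).eval x = (n ! : ℝ) := by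
    intro x
    have : derivative^[n - 1] (derivative p) = derivative^[n] p := by
      rw [← Function.iterate_succ_apply]; congr 1; omega
    rw [this, iterate_derivative_natDegree_of_monic hmon hdeg, eval_C]
  have hn0 : (n ! : ℝ) ≠ 0 := by positivity
  have hterm : ∀ k ∈ Finset.range (n - 1),
      (-1) ^ n / (n ! : ℝ) * ((-1) ^ (n - 1 - 1 - k) *
        (iteratedDerivWithin k f (Icc a b) b *
            (derivative^[n - 1 - 1 - k] (derivative p)).eval b -
          iteratedDerivWithin k f (Icc a b) a *
            (derivative^[n - 1 - 1 - k] (derivative p)).eval a)) =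
      1 / ((n - 1)! : ℝ) * (((b - a) ^ (k + 1) * ((2 * n - k - 2)! : ℝ) * ((n - k - 1)! : ℝ) /
        (2 ^ (2 * k + 1) * ((2 * n - 2 * k - 2)! : ℝ) * ((k + 1)! : ℝ))) *
      (iteratedDerivWithin k f (Icc a b) a +
        (-1) ^ k * iteratedDerivWithin k f (Icc a b) b)) := by
    intro k hk
    rw [Finset.mem_range] at hk
    obtain ⟨j, hj⟩ : ∃ j, n = j + 1 + k + 1 := ⟨n - k - 2, by omega⟩
    have e1 : n - 1 - 1 - k = j := by omega
    have e2 : 2 * n - k - 2 = 2 * (j + 1) + k := by omega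
    have e3 : n - k - 1 = j + 1 := by omega
    have e4 : 2 * n - 2 * k - 2 = 2 * (j + 1) := by omega
    have e5 : n - 1 = j + 1 + k := by omega
    have e6 : n + (j + 1) = 2 * (j + 1) + (k + 1) := by omega
    have hr := eval_iterate_derivative_minPolyOn_right (m := j + 1) (k := k) (by omega) hab
    rw [← hj, ← hp] at hr
    have hl := eval_iterate_derivative_minPolyOn_left (n := n) (m := j + 1) (by omega) hab
    rw [e6, ← hp] at hl
    rw [e1, e2, e3, e4, e5, ← Function.iterate_succ_apply, Nat.succ_eq_add_one, hl,
      ← mul_assoc (1 / ((j + 1 + k)! : ℝ)), ← hr]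
    have s1 : ((-1 : ℝ)) ^ n * (-1) ^ j = (-1) ^ k := by
      rw [← pow_add, show n + j = 2 * (j + 1) + k by omega, pow_add, pow_mul]; simp
    have s2 : ((-1 : ℝ)) ^ (2 * (j + 1) + (k + 1)) = -(-1) ^ k := by
      rw [pow_add, pow_mul, pow_succ _ k]; simp
    have s3 : ((-1 : ℝ)) ^ k * (-1) ^ k = 1 := by rw [← mul_pow]; simp
    rw [s2]
    linear_combination
      (eval b (derivative^[j + 1] p) / (n ! : ℝ) *
        (iteratedDerivWithin k f (Icc a b) b +
          (-1) ^ k * iteratedDerivWithin k f (Icc a b) a)) * s1 +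
      (eval b (derivative^[j + 1] p) / (n ! : ℝ) * iteratedDerivWithin k f (Icc a b) a) * s3
  -- `φ_n(a)` is proportional to `(-1)^n - 1`: zero for even `n`, twice the negative scale for odd
  -- `n`.
  have hrem : (-1) ^ n / (n ! : ℝ) * (K * p.eval a) = if Odd n then
      (b - a) ^ n * K / ((n ! : ℝ) * 2 ^ (2 * n - 2)) else 0 := by
    rw [hp, eval_minPolyOn_left n hab]
    have hs := minPolyScale_eq hn a b
    split_ifs with ho
    · rw [ho.neg_one_pow]
      have : (b - a) ^ n * K / ((n ! : ℝ) * 2 ^ (2 * n - 2)) =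
          (b - a) ^ n / 2 ^ (2 * n - 2) * K / (n ! : ℝ) := by field_simp
      rw [this, ← hs]; ring
    · rw [(Nat.not_odd_iff_even.mp ho).neg_one_pow]; simp
  have hsign : (-1 : ℝ) ^ n * (-1) ^ (n - 1) = -1 := by
    rw [← pow_add]
    exact Odd.neg_one_pow ⟨n - 1, by omega⟩
  rw [quadRule, quadError_eq hn hab hf, ← hp, ← hK, hint,
    integral_iteratedDerivWithin_mul_eval hab (n - 1) hf, ← hrem, Finset.mul_sum,
    ← Finset.sum_congr rfl hterm, ← Finset.mul_sum]
  simp only [hiter]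
  rw [intervalIntegral.integral_mul_const]
  have : (∫ x in a..b, f x) = -((-1) ^ n / (n ! : ℝ) *
      ((-1) ^ (n - 1) * ((∫ x in a..b, f x) * (n ! : ℝ)))) := by
    field_simp
    linear_combination (∫ x in a..b, f x) * hsign
  linear_combination this

/-! ### Sharpness of the coefficient -/

lemma exists_contDiff_iteratedDeriv_eq (m : ℕ) {F : ℝ → ℝ} (hF : Continuous F) :
    ∃ f : ℝ → ℝ, ContDiff ℝ (m : WithTop ℕ∞) f ∧ iteratedDeriv m f = F := by
  induction m with
  | zero => exact ⟨F, by simpa using hF, iteratedDeriv_zero⟩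
  | succ m ih =>
    obtain ⟨g, hg, hgF⟩ := ih
    have hd : ∀ x, HasDerivAt (fun x => ∫ t in (0 : ℝ)..x, g t) (g x) x := fun x =>
      intervalIntegral.integral_hasDerivAt_right (hg.continuous.intervalIntegrable _ _)
        (hg.continuous.stronglyMeasurableAtFilter _ _) hg.continuous.continuousAt
    have hderiv : deriv (fun x => ∫ t in (0 : ℝ)..x, g t) = g := funext fun x => (hd x).deriv
    refine ⟨fun x => ∫ t in (0 : ℝ)..x, g t, ?_, ?_⟩
    · push_cast
      rw [contDiff_succ_iff_deriv, hderiv]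
      exact ⟨fun x => (hd x).differentiableAt, by simp, hg⟩
    · rw [iteratedDeriv_succ', hderiv, hgF]

/-- Between consecutive nodes the increment of `p` is at most `∫ |p'|`, so the alternating sum
bounds the total without any sign analysis of `p'`. -/
lemma le_integral_abs_derivative {n : ℕ} (hn : 1 ≤ n) {a b : ℝ} {p : ℝ[X]} (hab : a < b)
    (hp : p.Monic) (hpn : p.natDegree = n) :
    n * (b - a) ^ n / 2 ^ (2 * n - 2) ≤ ∫ x in a..b, |p.derivative.eval x| := by
  have hpc : Continuous fun x => p.derivative.eval x := p.derivative.continuous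
  rw [← altSum_eval_nodeOn hn p hp hpn]
  have h0 : nodeOn n a b 0 = b := by rw [nodeOn, Chebyshev.node_eq_one]; ring
  have hlast : nodeOn n a b n = a := by
    rw [nodeOn, Chebyshev.node_eq_neg_one (by omega)]; ring
  have htot := intervalIntegral.sum_integral_adjacent_intervals (a := nodeOn n a b) (n := n)
    (f := fun x => |p.derivative.eval x|) (μ := volume)
    fun k _ => hpc.abs.intervalIntegrable _ _
  rw [h0, hlast, intervalIntegral.integral_symm] at htot
  rw [← neg_neg (∫ x in a..b, |p.derivative.eval x|), ← htot, ← Finset.sum_neg_distrib]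
  refine Finset.sum_le_sum fun k hk => ?_
  have hle := (nodeOn_lt hab (Finset.mem_range.mp hk) (Nat.lt_succ_self k)).le
  rw [← intervalIntegral.integral_symm]
  refine (le_abs_self _).trans ?_
  rw [abs_mul, abs_pow, abs_neg, abs_one, one_pow, one_mul,
    ← intervalIntegral.integral_eq_sub_of_hasDerivAt (fun s _ => p.hasDerivAt s)
      (hpc.intervalIntegrable _ _)]
  exact intervalIntegral.abs_integral_le_integral_abs hle

/-- A continuous approximation of the sign of `g` that vanishes at `a` and is bounded by `1`. -/
def signApprox (g : ℝ → ℝ) (a ε x : ℝ) : ℝ := |x - a| / (|x - a| + ε) * (g x / (|g x| + ε))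

lemma continuous_signApprox {g : ℝ → ℝ} (hg : Continuous g) (a : ℝ) {ε : ℝ} (hε : 0 < ε) :
    Continuous (signApprox g a ε) := by
  have h1 : ∀ x, |x - a| + ε ≠ 0 := fun x => by positivity
  have h2 : ∀ x, |g x| + ε ≠ 0 := fun x => by positivity
  unfold signApprox
  fun_prop (disch := assumption)

lemma abs_signApprox_le_one (g : ℝ → ℝ) (a : ℝ) {ε : ℝ} (hε : 0 < ε) (x : ℝ) :
    |signApprox g a ε x| ≤ 1 := by
  have key : ∀ u : ℝ, |u| / (|u| + ε) ≤ 1 := fun u =>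
    (div_le_one (by positivity)).mpr (by linarith)
  rw [signApprox, abs_mul, abs_div, abs_div, abs_abs,
    abs_of_pos (by positivity : 0 < |x - a| + ε), abs_of_pos (by positivity : 0 < |g x| + ε)]
  exact mul_le_one₀ (key _) (by positivity) (key _)

lemma tendsto_integral_signApprox_mul {g : ℝ → ℝ} (hg : Continuous g) {a b : ℝ} (hab : a < b) :
    Filter.Tendsto (fun ε => ∫ x in a..b, signApprox g a ε x * g x) (nhdsWithin 0 (Ioi 0))
      (nhds (∫ x in a..b, |g x|)) := by
  refine intervalIntegral.tendsto_integral_filter_of_dominated_convergence (fun x => |g x|) ?_ ?_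
    (hg.abs.intervalIntegrable _ _) ?_
  · filter_upwards [self_mem_nhdsWithin] with ε hε
    exact ((continuous_signApprox hg a hε).mul hg).aestronglyMeasurable
  · filter_upwards [self_mem_nhdsWithin] with ε hε
    refine Filter.Eventually.of_forall fun x _ => ?_
    rw [norm_mul, Real.norm_eq_abs, Real.norm_eq_abs]
    exact mul_le_of_le_one_left (abs_nonneg _) (abs_signApprox_le_one g a hε x)
  · refine Filter.Eventually.of_forall fun x hx => ?_
    rw [uIoc_of_le hab.le] at hx
    have hxa : |x - a| ≠ 0 := abs_ne_zero.mpr (sub_ne_zero.mpr hx.1.ne')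
    by_cases hgx : g x = 0
    · simp [hgx]
    have hgx' : |g x| ≠ 0 := abs_ne_zero.mpr hgx
    -- With `x ≠ a` and `g x ≠ 0` no denominator vanishes at `ε = 0`, where the value is `|g x|`.
    have hc : ContinuousAt (fun ε => signApprox g a ε x * g x) 0 := by
      unfold signApprox
      have h1 : |x - a| + 0 ≠ 0 := by simpa using hxa
      have h2 : |g x| + 0 ≠ 0 := by simpa using hgx'
      fun_prop (disch := assumption)
    have h0 : signApprox g a 0 x * g x = |g x| := by
      rw [signApprox, add_zero, add_zero, div_self hxa, one_mul, div_mul_eq_mul_div,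
        ← abs_mul_abs_self, mul_div_assoc, div_self hgx', mul_one]
    have := hc.tendsto
    rw [h0] at this
    exact this.mono_left nhdsWithin_le_nhds

lemma le_of_forall_abs_quadError_le {n : ℕ} (hn : 1 ≤ n) {a b : ℝ} (hab : a < b) {c : ℝ}
    (hc : ∀ f : ℝ → ℝ, ContDiffOn ℝ ((n - 1 : ℕ) : WithTop ℕ∞) f (Icc a b) →
      |quadError n a b f| ≤ c * alexNorm (distDerivFun n a b f)) :
    (b - a) ^ n / (((n - 1)! : ℝ) * 2 ^ (2 * n - 2)) ≤ c := by
  obtain ⟨hmon, hdeg⟩ := minPolyOn_monic_natDegree hn hab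
  have hba : 0 < b - a := by linarith
  set g : ℝ → ℝ := fun x => (minPolyOn n a b).derivative.eval x
  have hgc : Continuous g := (minPolyOn n a b).derivative.continuous
  -- The sign of `c` is not known yet, and replacing the norm by its bound `1` needs a nonnegative
  -- factor; positivity of the limit later discards the `0`.
  have hbound : ∀ ε > 0, 1 / (n ! : ℝ) * |∫ x in a..b, signApprox g a ε x * g x| ≤ max c 0 := by
    intro ε hε
    obtain ⟨f, hf, hfF⟩ := exists_contDiff_iteratedDeriv_eq (n - 1) (continuous_signApprox hgc a hε)
    have hiter : ∀ x ∈ Icc a b, iteratedDerivWithin (n - 1) f (Icc a b) x = signApprox g a ε x := by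
      intro x hx
      rw [iteratedDerivWithin_eq_iteratedDeriv (uniqueDiffOn_Icc hab) hf.contDiffAt hx, hfF]
    have ha : signApprox g a ε a = 0 := by simp [signApprox]
    have hF := isPrimitive_distDerivFun hn hab hf.contDiffOn
    have hnorm := hF.alexNorm_eq hab
    have h1 := hc f hf.contDiffOn
    have h2 : quadError n a b f = (-1) ^ n / (n ! : ℝ) *
        -∫ x in a..b, signApprox g a ε x * g x := by
      rw [quadError_eq hn hab hf.contDiffOn]
      congr 2
      refine intervalIntegral.integral_congr fun x hx => ?_
      rw [uIcc_of_le hab.le] at hx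
      simp only [hiter x hx, hiter a (left_mem_Icc.mpr hab.le), ha, sub_zero]
      rfl
    rw [h2, abs_mul, abs_neg, abs_div, abs_pow, abs_neg, abs_one, one_pow, Nat.abs_cast] at h1
    have hN0 : 0 ≤ alexNorm (distDerivFun n a b f) := by
      rw [hnorm]
      refine Real.sSup_nonneg ?_
      rintro _ ⟨x, _, rfl⟩
      exact abs_nonneg _
    have hN1 : alexNorm (distDerivFun n a b f) ≤ 1 := by
      rw [hnorm]
      refine Real.sSup_le ?_ zero_le_one
      rintro _ ⟨x, hx, rfl⟩
      simp only [hiter x hx, hiter a (left_mem_Icc.mpr hab.le), ha, sub_zero]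
      exact abs_signApprox_le_one g a hε x
    refine h1.trans ?_
    calc _ ≤ max c 0 * alexNorm (distDerivFun n a b f) := by gcongr; exact le_max_left _ _
      _ ≤ max c 0 := mul_le_of_le_one_right (le_max_right _ _) hN1
  have hlim := ((tendsto_integral_signApprox_mul hgc hab).abs).const_mul (1 / (n ! : ℝ))
  have hle := le_of_tendsto hlim (by
    filter_upwards [self_mem_nhdsWithin] with ε hε using hbound ε hε)
  have hV := le_integral_abs_derivative hn hab hmon hdeg
  have hmain : (b - a) ^ n / (((n - 1)! : ℝ) * 2 ^ (2 * n - 2)) ≤ max c 0 := by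
    refine le_trans ?_ hle
    refine le_trans ?_ (mul_le_mul_of_nonneg_left (hV.trans (le_abs_self _)) (by positivity))
    obtain ⟨m, rfl⟩ : ∃ m, n = m + 1 := ⟨n - 1, by omega⟩
    rw [Nat.add_sub_cancel, Nat.factorial_succ]
    push_cast
    apply le_of_eq
    field_simp
  have hpos : 0 < (b - a) ^ n / (((n - 1)! : ℝ) * 2 ^ (2 * n - 2)) := by positivity
  exact (le_max_iff.mp hmain).resolve_right (not_le.mpr hpos)

end CPI

end


theorem mainTheorem3 (n : ℕ) (hn : 1 ≤ n) (a b : ℝ) (hab : a < b) :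
    -- the polynomial `φ_n` is the unique minimizer of `|p(b)| + Vp` among the monic
    -- polynomials of degree `n`
    ((CPI.minPolyOn n a b).Monic ∧ (CPI.minPolyOn n a b).natDegree = n ∧
      ∀ p : Polynomial ℝ, p.Monic → p.natDegree = n → p ≠ CPI.minPolyOn n a b →
        CPI.holderFactor a b (CPI.minPolyOn n a b) < CPI.holderFactor a b p) ∧
    -- integrability, the quadrature formula and the error estimate
    (∀ f : ℝ → ℝ, ContDiffOn ℝ ((n - 1 : ℕ) : WithTop ℕ∞) f (Set.Icc a b) →
      CPI.distDerivFun n a b f ∈ CPI.Ac a b ∧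
      (∃ I : ℝ, CPI.HasCPIntegralMul (CPI.distDerivFun n a b f)
        (fun x => (CPI.minPolyOn n a b).eval x) I) ∧
      ∫ x in a..b, f x = CPI.quadRule n a b f + CPI.quadError n a b f ∧
      |CPI.quadError n a b f| ≤
        CPI.alexNorm (CPI.distDerivFun n a b f) * (b - a) ^ n /
          ((Nat.factorial (n - 1) : ℝ) * 2 ^ (2 * n - 2))) ∧
    -- sharpness of the coefficient
    (∀ c : ℝ,
      (∀ f : ℝ → ℝ, ContDiffOn ℝ ((n - 1 : ℕ) : WithTop ℕ∞) f (Set.Icc a b) →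
        |CPI.quadError n a b f| ≤ c * CPI.alexNorm (CPI.distDerivFun n a b f)) →
      (b - a) ^ n / ((Nat.factorial (n - 1) : ℝ) * 2 ^ (2 * n - 2)) ≤ c) := by
  obtain ⟨hmon, hdeg⟩ := CPI.minPolyOn_monic_natDegree hn hab
  refine ⟨⟨hmon, hdeg, fun p hp hpn hne => ?_⟩, fun f hf => ?_, fun c hc =>
    CPI.le_of_forall_abs_quadError_le hn hab hc⟩
  · refine lt_of_not_ge fun hle => hne ?_
    exact CPI.eq_minPolyOn_of_holderFactor_le hn hab hp hpn
      (hle.trans (CPI.holderFactor_minPolyOn_le hn hab))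
  · have hF := CPI.isPrimitive_distDerivFun hn hab hf
    exact ⟨⟨_, hF⟩, ⟨_, hF.hasCPIntegralMul hab _⟩,
      CPI.integral_eq_quadRule_add_quadError hn hab hf, CPI.abs_quadError_le hn hab hf⟩
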